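/- For $\tau\in\mathbb H=\{\operatorname{Im}\tau>0\}$ let $\Lambda_\tau=\mathbb Z+\mathbb Z\tau$ and $$g_2(\tau)=60\sum_{(m,n)\in\mathbb Z^2\setminus\{(0,0)\}}\frac1{(m\tau+n)^{4}},\qquad g_3(\tau)=140\sum_{(m,n)\in\mathbb Z^2\setminus\{(0,0)\}}\frac1{(m\tau+n)^{6}},$$ $$\zeta(z;\tau)=\frac1z+\sum_{\omega\in\Lambda_\tau\setminus\{0\}}\Big(\frac1{z-\omega}+\frac1\omega+\frac z{\omega^2}\Big),\qquad \eta_1(\tau)=2\zeta(\tfrac12;\tau),\quad \eta_2(\tau)=2\zeta(\tfrac\tau2;\tau).$$ Let $F_0=\{\tau\in\mathbb H : 0\le\operatorname{Re}\tau\le1,\ |\tau-\tfrac12|\ge\tfrac12\}$, with interior $\mathring F_0$, and for $C\in\mathbb R$ let $$f_C(\tau)=(C-\tau)\,g_2(\tau)^2-18\,\bigl(C\eta_1(\tau)-\eta_2(\tau)\bigr)\,g_3(\tau).$$ **Theorem 3.1 (Unique-pole).** The derivative $g_3'$ has a unique zero $\tau_\infty$ in $F_0$, and $\tau_\infty=\tfrac12+ib_\infty$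 with $b_\infty\in(\tfrac12,\tfrac{\sqrt3}2)$. Moreover: 1. For every $C\in\mathbb R\setminus\{0,1\}$, $f_C$ has exactly two distinct zeros in $F_0$; both belong to $\mathring F_0$ and are simple. 2. $\tau_0:=\frac1{1-\tau_\infty}\in\mathring F_0$ is the unique zero of $f_0$ in $F_0$; moreover $\operatorname{Re}\tau_0>\tfrac12$ and $|\tau_0-1|=1$. 3. $\tau_1:=\frac{\tau_\infty-1}{\tau_\infty}\in\mathring F_0$ is the unique zero of $f_1$ in $F_0$; moreover $\tau_1=1-\overline{\tau_0}$, $\operatorname{Re}\tau_1<\tfrac12$ and $|\tau_1|=1$. -/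

import Mathlib

open UpperHalfPlane

noncomputable section

/-- The period pair `(1, τ)`, whose lattice is `Λ_τ = ℤ + ℤτ`. -/
def tauPeriods (τ : ℍ) : PeriodPair where
  ω₁ := 1
  ω₂ := (τ : ℂ)
  indep := by
    rw [LinearIndependent.pair_iff]
    intro s t h
    have him := congrArg Complex.im h
    have hre := congrArg Complex.re h
    have ht : t = 0 := by simpa [τ.im_ne_zero] using him
    subst ht
    exact ⟨by simpa using hre, rfl⟩

/-- The Weierstrass zeta function of a lattice,
`ζ(z) = 1/z + ∑_{l ∈ Λ, l ≠ 0} (1/(z - l) + 1/l + z/l²)`.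
The term `1/z` is the summand at `l = 0`, since `1 / 0 = 0` and `z / 0 = 0`. -/
def weierstrassZeta (L : PeriodPair) (z : ℂ) : ℂ :=
  ∑' l : L.lattice, (1 / (z - l) + 1 / (l : ℂ) + z / (l : ℂ) ^ 2)

/-- `g₂(τ) = 60 ∑' (mτ + n)⁻⁴`. -/
def g2 (τ : ℍ) : ℂ := (tauPeriods τ).g₂

/-- `g₃(τ) = 140 ∑' (mτ + n)⁻⁶`. -/
def g3 (τ : ℍ) : ℂ := (tauPeriods τ).g₃

/-- The quasi-period `η₁(τ) = 2 ζ(1/2; τ)`. -/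
def eta1 (τ : ℍ) : ℂ := 2 * weierstrassZeta (tauPeriods τ) (1 / 2)

/-- The quasi-period `η₂(τ) = 2 ζ(τ/2; τ)`. -/
def eta2 (τ : ℍ) : ℂ := 2 * weierstrassZeta (tauPeriods τ) ((τ : ℂ) / 2)

/-- `f_C(τ) = (C - τ) g₂(τ)² - 18 (C η₁(τ) - η₂(τ)) g₃(τ)`. -/
def fC (C : ℝ) (τ : ℍ) : ℂ :=
  ((C : ℂ) - (τ : ℂ)) * g2 τ ^ 2 - 18 * ((C : ℂ) * eta1 τ - eta2 τ) * g3 τ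

/-- The basic fundamental domain `F₀` of `Γ₀(2)`. -/
def F0 : Set ℍ :=
  {τ | 0 ≤ τ.re ∧ τ.re ≤ 1 ∧ 1 / 2 ≤ ‖(τ : ℂ) - 1 / 2‖}

/-- The complex derivative of a function on the upper half-plane. -/
def derivH (f : ℍ → ℂ) (τ : ℍ) : ℂ := deriv (fun z : ℂ => f (ofComplex z)) (τ : ℂ)

/-- `f : ℍ → ℂ` is holomorphic near `τ` and has a zero of order exactly one there. -/
def IsSimpleZero (f : ℍ → ℂ) (τ : ℍ) : Prop :=
  analyticOrderAt (fun z : ℂ => f (ofComplex z)) (τ : ℂ) = 1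

end

/-!
The zeros of `f_C` are the points where an equivariant function takes the value `C`.

Write `E₆'` for the derivative of `E₆` and `h(z) = z + 6 E₆/E₆'`. Legendre's relation
`η₂ = τ η₁ - 2πi` (`eta2_eq`), the expressions of `g₂`, `g₃`, `η₁` through `E₄`, `E₆`, `E₂`, and
Ramanujan's identity `D E₆ = (E₂E₆ - E₄²)/2` (`ramanujan_E₆`) show that `f_C` is a constant times
`C E₆' - (zE₆' + 6E₆)`; it belongs to the `pencil` of functions `A E₆' - B (zE₆' + 6E₆)`, and
vanishes exactly where `h = C` (`fC_eq_pencil`, `pencil_eq_mul`). The derivative of `g₃` is, up to a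
constant, the member `(A, B) = (1, 0)` of the pencil. Modularity of `E₆` makes `h` equivariant,
`h(γz) = γ h(z)`; on the pencil this says that the order three rotation `z ↦ 1/(1 - z)`
permutes its members (`pencil_rotate`). The rotation and its inverse carry the two parts of `F₀`
inside the discs `|z - 1| < 1`, `|z| < 1` to the fundamental domain
`F = {0 ≤ Re z ≤ 1, |z| ≥ 1, |z - 1| ≥ 1}`. So it suffices to know where `h` is real on `F`.

The reflection `z ↦ 1 - z̄` satisfies `h(1 - z̄) = 1 - conj h(z)` and reduces this to the left half
`Re z ≤ 1/2` of `F`. There the leading term `1/q` of `E₆/(qE₆')` governs the signs: `Im h` is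
negative at heights at most `0.95` and on the line `Re z = 1/2`, positive on the imaginary axis, and
above height `0.95` one has `Im h' < 0` inside the strip. The last sign makes `h` injective and
`Im h` strictly monotone on horizontal segments, so that `Im h = 0` is a continuous graph
`x = X(y)` on which `h` is injective and positive and tends to infinity. On the unit circle
`-1/z = -z̄` forces `|h| = 1`; hence the graph leaves the unit disc at its only point with `h = 1`,
and above that point `h` runs bijectively through `(1, ∞)` (`exists_height`).

Consequently on `F` every real `C > 1` is a value of `h` at exactly one point, interior and to the
left; every `C < 0` likewise to the right; `C = 1` and `C = 0` are taken once each, on `|z| = 1` and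
`|z - 1| = 1`; and no value in `(0, 1)` is taken. The zeros in the three parts of `F₀` are
read off from `C`, `1/(1 - C)` and `(C - 1)/C`, of which exactly one lies in `(0, 1)` when
`C ≠ 0, 1` (`exists_pair_of_zeros`). Simplicity is `h' ≠ 0`. The points `τ₁`, `τ₀`, `τ_∞` form one
orbit of the rotation.
-/

noncomputable section

open Complex Filter Topology ArithmeticFunction

/-! ### The series `∑ nᵏ σ₅(n) qⁿ` as functions of `z` -/

/-- The series `∑ nᵏ σ₅(n) qⁿ`. With `q = exp (2πiz)`, `1 - 504 ∑ σ₅(n) qⁿ` is the Eisenstein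
series `E₆`, and raising `k` by one is `(2πi)⁻¹ d/dz`. -/
def sigmaSeries (k : ℕ) (q : ℂ) : ℂ := ∑' n : ℕ, (n : ℂ) ^ k * (sigma 5 n : ℂ) * q ^ n

/-- The nome `q = exp (2πiz)`. -/
def nome (z : ℂ) : ℂ := cexp (2 * Real.pi * Complex.I * z)

lemma norm_nome (z : ℂ) : ‖nome z‖ = Real.exp (-2 * Real.pi * z.im) := by
  simp [nome, Complex.norm_exp]

lemma norm_nome_lt_one {z : ℂ} (hz : 0 < z.im) : ‖nome z‖ < 1 := by
  rw [norm_nome, Real.exp_lt_one_iff]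
  nlinarith [Real.pi_pos]

lemma nome_ne_zero (z : ℂ) : nome z ≠ 0 := exp_ne_zero _

lemma hasDerivAt_nome (z : ℂ) : HasDerivAt nome (2 * Real.pi * Complex.I * nome z) z := by
  have := ((hasDerivAt_id z).const_mul (2 * Real.pi * Complex.I : ℂ)).cexp
  refine this.congr_deriv ?_
  simp only [nome, id, mul_one]
  ring

lemma nome_add_one (z : ℂ) : nome (z + 1) = nome z := by
  simp [nome, mul_add, Complex.exp_add, Complex.exp_two_pi_mul_I]

lemma nome_neg_conj (z : ℂ) :
    nome (-(starRingEnd ℂ) z) = (starRingEnd ℂ) (nome z) := by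
  simp [nome, ← Complex.exp_conj, Complex.conj_ofNat]

lemma norm_sigmaSeries_term_le (k n : ℕ) (q : ℂ) :
    ‖(n : ℂ) ^ k * (sigma 5 n : ℂ) * q ^ n‖ ≤ (n : ℝ) ^ (k + 6) * ‖q‖ ^ n := by
  rw [norm_mul, norm_mul, norm_pow, norm_pow, norm_natCast, norm_natCast, pow_add]
  gcongr
  exact_mod_cast sigma_le_pow_succ 5 n

lemma summable_sigmaSeries (k : ℕ) {q : ℂ} (hq : ‖q‖ < 1) :
    Summable fun n : ℕ ↦ (n : ℂ) ^ k * (sigma 5 n : ℂ) * q ^ n := by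
  refine Summable.of_norm_bounded
    (summable_pow_mul_geometric_of_norm_lt_one (k + 6) (r := ‖q‖) (by simpa)) fun n ↦ ?_
  exact norm_sigmaSeries_term_le k n q

lemma hasDerivAt_tsum_mul_nome_pow {c : ℕ → ℂ} {m : ℕ} (hc : ∀ n, ‖c n‖ ≤ (n : ℝ) ^ m) {z : ℂ}
    (hz : 0 < z.im) : HasDerivAt (fun w ↦ ∑' n, c n * nome w ^ n)
      (∑' n : ℕ, 2 * Real.pi * Complex.I * (n * c n * nome z ^ n)) z := by
  obtain ⟨r, hr⟩ : ∃ r : ℝ, r = Real.exp (-2 * Real.pi * (z.im / 2)) := ⟨_, rfl⟩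
  have hr1 : r < 1 := by
    have := mul_pos Real.pi_pos hz
    rw [hr, Real.exp_lt_one_iff]
    linarith
  have hr2 : ‖r‖ < 1 := by
    rwa [Real.norm_of_nonneg]
    rw [hr]
    positivity
  have hu : Summable fun n : ℕ ↦ 2 * Real.pi * ((n : ℝ) ^ (m + 1) * r ^ n) :=
    (summable_pow_mul_geometric_of_norm_lt_one (m + 1) hr2).mul_left _
  have hopen : IsOpen {w : ℂ | z.im / 2 < w.im} := isOpen_lt continuous_const continuous_im
  have hconv : IsPreconnected {w : ℂ | z.im / 2 < w.im} :=
    (convex_halfSpace_im_gt _).isPreconnected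
  have hmem : z ∈ {w : ℂ | z.im / 2 < w.im} := by
    change z.im / 2 < z.im
    linarith
  refine hasDerivAt_tsum_of_isPreconnected (𝕜 := ℂ) hu hopen hconv
    (g := fun (n : ℕ) w ↦ c n * nome w ^ n)
    (g' := fun (n : ℕ) w ↦ 2 * Real.pi * Complex.I * (n * c n * nome w ^ n))
    (y₀ := z) (y := z) ?_ ?_ hmem ?_ hmem
  · intro n w _
    refine (((hasDerivAt_nome w).pow n).const_mul (c n)).congr_deriv ?_
    rcases n with _ | n
    · simp
    · simp only [Nat.add_sub_cancel]
      ring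
  · intro n w hw
    have h2 : ‖(2 * Real.pi * Complex.I : ℂ)‖ = 2 * Real.pi := by
      simp [abs_of_pos Real.pi_pos]
    rw [norm_mul, h2, norm_mul, norm_mul, norm_pow, norm_natCast, pow_succ', norm_nome]
    have hw' : z.im / 2 < w.im := hw
    have he : Real.exp (-2 * Real.pi * w.im) ≤ r := by
      rw [hr]
      apply Real.exp_le_exp.mpr
      nlinarith [Real.pi_pos]
    have := hc n
    gcongr
  · refine Summable.of_norm_bounded
      (summable_pow_mul_geometric_of_norm_lt_one m (r := ‖nome z‖)
        (by simpa using norm_nome_lt_one hz)) fun n ↦ ?_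
    rw [norm_mul, norm_pow]
    have := hc n
    gcongr

lemma hasDerivAt_sigmaSeries_nome (k : ℕ) {z : ℂ} (hz : 0 < z.im) :
    HasDerivAt (fun w ↦ sigmaSeries k (nome w))
      (2 * Real.pi * Complex.I * sigmaSeries (k + 1) (nome z)) z := by
  have hc : ∀ n : ℕ, ‖(n : ℂ) ^ k * (sigma 5 n : ℂ)‖ ≤ (n : ℝ) ^ (k + 6) := fun n ↦ by
    simpa using norm_sigmaSeries_term_le k n 1
  refine (hasDerivAt_tsum_mul_nome_pow hc hz).congr_deriv ?_
  rw [tsum_mul_left, sigmaSeries]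
  congr 1
  refine tsum_congr fun n ↦ ?_
  rw [pow_succ']
  ring

lemma sigmaSeries_conj (k : ℕ) (q : ℂ) :
    sigmaSeries k ((starRingEnd ℂ) q) = (starRingEnd ℂ) (sigmaSeries k q) := by
  simp [sigmaSeries, Complex.conj_tsum]

/-! ### Lattice sums and Legendre's relation -/

lemma tsum_tauPeriods_lattice (τ : ℍ) (f : ℂ → ℂ) :
    ∑' l : (tauPeriods τ).lattice, f l = ∑' p : ℤ × ℤ, f (p.1 * (τ : ℂ) + p.2) := by
  rw [← (((Equiv.prodComm ℤ ℤ).trans (tauPeriods τ).latticeEquivProd.symm.toEquiv)).tsum_eq]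
  refine tsum_congr fun p ↦ ?_
  have := (tauPeriods τ).latticeEquiv_symm_apply p.swap
  simp only [Prod.fst_swap, Prod.snd_swap] at this
  simp only [Equiv.trans_apply, Equiv.prodComm_apply, LinearEquiv.coe_toEquiv, this]
  congr 1
  simp [tauPeriods, add_comm]

lemma summable_tauPeriods_lattice (τ : ℍ) (f : ℂ → ℂ) :
    Summable (fun l : (tauPeriods τ).lattice ↦ f l) ↔
      Summable fun p : ℤ × ℤ ↦ f (p.1 * (τ : ℂ) + p.2) := by
  rw [← (((Equiv.prodComm ℤ ℤ).trans
    (tauPeriods τ).latticeEquivProd.symm.toEquiv)).summable_iff]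
  refine summable_congr fun p ↦ ?_
  have := (tauPeriods τ).latticeEquiv_symm_apply p.swap
  simp only [Prod.fst_swap, Prod.snd_swap] at this
  simp only [Function.comp_apply, Equiv.trans_apply, Equiv.prodComm_apply,
    LinearEquiv.coe_toEquiv, this]
  congr 1
  simp [tauPeriods, add_comm]

/-- The summands of the Weierstrass zeta function are `O(|l|⁻³)`. -/
lemma summable_weierstrassZeta (L : PeriodPair) (z : ℂ) :
    Summable fun l : L.lattice ↦ 1 / (z - l) + 1 / (l : ℂ) + z / (l : ℂ) ^ 2 := by
  refine (L.hasSumLocallyUniformly_aux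
    (fun l z ↦ 1 / (z - l) + 1 / (l : ℂ) + z / (l : ℂ) ^ 2)
    (u := fun r l ↦ 2 * r ^ 2 * ‖l‖ ^ (-3 : ℝ))
    (fun _ _ ↦ (ZLattice.summable_norm_rpow _ _ (by simp; norm_num)).mul_left _) fun r hr ↦
    Filter.eventually_atTop.mpr ⟨2 * r, ?_⟩).hasSum (x := z) |>.summable
  rintro _ h s hs l rfl
  have hl : 0 < ‖(l : ℂ)‖ := by
    have : 2 * r ≤ ‖(l : ℂ)‖ := h
    linarith
  have hl0 : (l : ℂ) ≠ 0 := norm_pos_iff.mp hl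
  have h2 : ‖(l : ℂ)‖ / 2 ≤ ‖s - l‖ := by
    have h3 : 2 * r ≤ ‖(l : ℂ)‖ := h
    have := norm_sub_norm_le (l : ℂ) s
    rw [norm_sub_rev] at this
    linarith
  have hsl : s - l ≠ 0 := norm_pos_iff.mp (by linarith)
  have : 1 / (s - l) + 1 / (l : ℂ) + s / (l : ℂ) ^ 2 = s ^ 2 / ((s - l) * (l : ℂ) ^ 2) := by
    field_simp
    ring
  rw [this, norm_div, norm_mul, norm_pow, norm_pow, div_le_iff₀ (by positivity)]
  have h3 : ‖(l : L.lattice)‖ ^ (-3 : ℝ) = (‖(l : ℂ)‖ ^ 3)⁻¹ := by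
    rw [show (-3 : ℝ) = -((3 : ℕ) : ℝ) by norm_num, Real.rpow_neg (norm_nonneg _),
      Real.rpow_natCast]
    rfl
  rw [h3]
  calc ‖s‖ ^ 2 ≤ r ^ 2 := by gcongr
    _ = 2 * r ^ 2 * (‖(l : ℂ)‖ ^ 3)⁻¹ * (‖(l : ℂ)‖ / 2 * ‖(l : ℂ)‖ ^ 2) := by field_simp
    _ ≤ _ := by gcongr

lemma hasSum_int_telescope {a : ℤ → ℂ} (hs : Summable fun n ↦ a (n + 1) - a n)
    (ht : Tendsto (fun n : ℕ ↦ a n) atTop (𝓝 0))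
    (hb : Tendsto (fun n : ℕ ↦ a (-n)) atTop (𝓝 0)) :
    ∑' n, (a (n + 1) - a n) = 0 := by
  have h1 : HasSum (fun n : ℕ ↦ a ((n : ℤ) + 1) - a n) (-a 0) := by
    have hs1 : Summable fun n : ℕ ↦ a ((n : ℤ) + 1) - a n :=
      hs.comp_injective (i := fun n : ℕ ↦ (n : ℤ)) Nat.cast_injective
    rw [hs1.hasSum_iff_tendsto_nat]
    have := ht.sub_const (a 0)
    rw [zero_sub] at this
    refine this.congr fun N ↦ ?_
    have := Finset.sum_range_sub (fun n : ℕ ↦ a (n : ℤ)) N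
    push_cast at this
    exact this.symm
  have h2 : HasSum (fun n : ℕ ↦ a (-((n : ℤ) + 1) + 1) - a (-((n : ℤ) + 1))) (a 0) := by
    have hs1 : Summable fun n : ℕ ↦ a (-((n : ℤ) + 1) + 1) - a (-((n : ℤ) + 1)) :=
      hs.comp_injective (i := fun n : ℕ ↦ -((n : ℤ) + 1)) fun m n h ↦ by simpa using h
    rw [hs1.hasSum_iff_tendsto_nat]
    have := hb.const_sub (a 0)
    rw [sub_zero] at this
    refine this.congr fun N ↦ ?_
    have := Finset.sum_range_sub' (fun n : ℕ ↦ a (-(n : ℤ))) N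
    push_cast at this
    rw [neg_zero] at this
    rw [← this]
    refine Finset.sum_congr rfl fun n _ ↦ ?_
    congr 2
    ring
  have := (HasSum.of_nat_of_neg_add_one (f := fun n ↦ a (n + 1) - a n) h1 h2).tsum_eq
  simpa using this

lemma tendsto_one_div_add_const_natCast (c : ℂ) :
    Tendsto (fun n : ℕ ↦ 1 / ((n : ℂ) + c)) atTop (𝓝 0) := by
  have h : Tendsto (fun n : ℕ ↦ (n : ℂ) + c) atTop (Bornology.cobounded ℂ) :=
    (tendsto_add_const_cobounded c).comp tendsto_natCast_atTop_cobounded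
  simpa [Function.comp_def] using (tendsto_inv₀_cobounded.comp h)

open EisensteinSeries SummationFilter in
/-- Along a row, `1/(l + 1/2) - 1/(l - 1/2)` telescopes. -/
lemma tsum_row_sub_eq_zero (τ : ℍ) (m : ℤ)
    (hd : Summable fun n : ℤ ↦
      1 / ((m * (τ : ℂ) + n) + 1 / 2) - 1 / ((m * (τ : ℂ) + n) - 1 / 2)) :
    ∑' n : ℤ, (1 / ((m * (τ : ℂ) + n) + 1 / 2) - 1 / ((m * (τ : ℂ) + n) - 1 / 2)) = 0 := by
  obtain ⟨c, hc⟩ : ∃ c : ℂ, c = m * (τ : ℂ) - 1 / 2 := ⟨_, rfl⟩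
  have hform : ∀ n : ℤ, 1 / ((m * (τ : ℂ) + n) + 1 / 2) - 1 / ((m * (τ : ℂ) + n) - 1 / 2) =
      1 / (((n + 1 : ℤ) : ℂ) + c) - 1 / ((n : ℂ) + c) := by
    intro n
    rw [hc]
    push_cast
    ring_nf
  rw [tsum_congr hform]
  rw [summable_congr hform] at hd
  refine hasSum_int_telescope (a := fun n ↦ 1 / ((n : ℂ) + c)) hd ?_ ?_
  · simpa using tendsto_one_div_add_const_natCast c
  · have := (tendsto_one_div_add_const_natCast (-c)).neg
    rw [neg_zero] at this
    refine this.congr fun n ↦ ?_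
    rw [← div_neg]
    push_cast
    ring_nf

open EisensteinSeries SummationFilter in
/-- Pairing `l` with `-l` turns `2ζ(1/2)` into `∑ (1/(l + 1/2) - 1/(l - 1/2) + 1/l²)`, in which the
first two terms telescope along each row of the lattice. -/
lemma eta1_eq_G2 (τ : ℍ) : eta1 τ = G2 τ := by
  have hs := summable_weierstrassZeta (tauPeriods τ) (1 / 2)
  have hneg := (Equiv.neg (tauPeriods τ).lattice).summable_iff.mpr hs
  have hterm : ∀ l : (tauPeriods τ).lattice,
      (1 / (1 / 2 - (l : ℂ)) + 1 / (l : ℂ) + 1 / 2 / (l : ℂ) ^ 2) +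
        (1 / (1 / 2 - ((-l : (tauPeriods τ).lattice) : ℂ)) +
          1 / ((-l : (tauPeriods τ).lattice) : ℂ) +
          1 / 2 / ((-l : (tauPeriods τ).lattice) : ℂ) ^ 2) =
      (1 / ((l : ℂ) + 1 / 2) - 1 / ((l : ℂ) - 1 / 2)) + 1 / (l : ℂ) ^ 2 := by
    intro l
    have h4 : (1 : ℂ) / (1 / 2 - l) = - (1 / ((l : ℂ) - 1 / 2)) := by
      rw [← div_neg, neg_sub]
    simp only [Submodule.coe_neg]
    rw [h4, sub_neg_eq_add, add_comm (1 / 2 : ℂ) (l : ℂ), div_neg, neg_sq]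
    ring
  have h2 : eta1 τ = ∑' l : (tauPeriods τ).lattice,
      ((1 / ((l : ℂ) + 1 / 2) - 1 / ((l : ℂ) - 1 / 2)) + 1 / (l : ℂ) ^ 2) := by
    rw [eta1, weierstrassZeta, two_mul]
    nth_rewrite 2 [← (Equiv.neg (tauPeriods τ).lattice).tsum_eq]
    exact (Summable.tsum_add hs hneg).symm.trans (tsum_congr hterm)
  have hsum := (hs.add hneg).congr hterm
  rw [tsum_tauPeriods_lattice τ
    (fun l ↦ (1 / (l + 1 / 2) - 1 / (l - 1 / 2)) + 1 / l ^ 2)] at h2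
  rw [summable_tauPeriods_lattice τ
    (fun l ↦ (1 / (l + 1 / 2) - 1 / (l - 1 / 2)) + 1 / l ^ 2)] at hsum
  have hrow : ∀ m : ℤ, ∑' n : ℤ, ((1 / ((m * (τ : ℂ) + n) + 1 / 2) -
      1 / ((m * (τ : ℂ) + n) - 1 / 2)) + 1 / (m * (τ : ℂ) + n) ^ 2) = e2Summand m τ := by
    intro m
    have hm := hsum.prod_factor m
    have he : Summable fun n : ℤ ↦ 1 / (m * (τ : ℂ) + n) ^ 2 :=
      (e2Summand_summable m τ).congr fun n ↦ by simp [eisSummand, zpow_neg]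
    have hd := (hm.sub he)
    simp only [add_sub_cancel_right] at hd
    rw [Summable.tsum_add hd he]
    rw [tsum_row_sub_eq_zero τ m hd, zero_add, e2Summand]
    refine tsum_congr fun n ↦ ?_
    simp [eisSummand, zpow_neg]
  rw [h2, hsum.tsum_prod, G2]
  have hse : Summable fun m ↦ e2Summand m τ := by
    refine hsum.prod.congr fun m ↦ ?_
    exact hrow m
  exact (tsum_congr hrow).trans
    (tsum_eq_of_summable_unconditional (L := symmetricIcc ℤ) hse).symm

/-- `Λ_τ = τ Λ_{-1/τ}`, so homogeneity of `ζ` exchanges the two quasi-periods. -/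
lemma eta2_eq_inv_mul_eta1 (τ : ℍ) : eta2 τ = (τ : ℂ)⁻¹ * eta1 (ModularGroup.S • τ) := by
  have hτ : (τ : ℂ) ≠ 0 := ne_zero τ
  rw [eta2, eta1, mul_left_comm, weierstrassZeta, weierstrassZeta]
  congr 1
  rw [tsum_tauPeriods_lattice τ (fun l ↦ 1 / ((τ : ℂ) / 2 - l) + 1 / l + (τ : ℂ) / 2 / l ^ 2),
    tsum_tauPeriods_lattice _ (fun l ↦ 1 / (1 / 2 - l) + 1 / l + 1 / 2 / l ^ 2),
    ← tsum_mul_left]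
  let e : ℤ × ℤ ≃ ℤ × ℤ :=
    ⟨fun p ↦ (p.2, -p.1), fun p ↦ (-p.2, p.1), fun p ↦ by simp, fun p ↦ by simp⟩
  rw [← e.tsum_eq]
  refine tsum_congr fun p ↦ ?_
  have hS : ((ModularGroup.S • τ : ℍ) : ℂ) = -(τ : ℂ)⁻¹ := by
    rw [UpperHalfPlane.modular_S_smul, UpperHalfPlane.coe_mk, inv_neg]
  have hw : ((e p).1 : ℂ) * (τ : ℂ) + (e p).2 = τ * (p.1 * (-(τ : ℂ)⁻¹) + p.2) := by
    simp only [e, Equiv.coe_fn_mk]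
    push_cast
    field_simp
    ring
  rw [hw, hS]
  obtain ⟨w, hw'⟩ : ∃ w : ℂ, w = p.1 * (-(τ : ℂ)⁻¹) + p.2 := ⟨_, rfl⟩
  rw [← hw', show (τ : ℂ) / 2 - τ * w = τ * (1 / 2 - w) by ring]
  simp only [mul_inv, div_eq_mul_inv, mul_pow]
  field_simp

/-- Legendre's relation. -/
lemma eta2_eq (τ : ℍ) : eta2 τ = τ * eta1 τ - 2 * Real.pi * Complex.I := by
  have hτ : (τ : ℂ) ≠ 0 := ne_zero τ
  have h := EisensteinSeries.G2_S_transform τ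
  rw [eta2_eq_inv_mul_eta1, eta1_eq_G2, eta1_eq_G2, h]
  field_simp
  ring

/-! ### `g₂`, `g₃`, `η₁` through Eisenstein series, and Ramanujan's identity -/

lemma tsum_pnat_sigmaSeries (z : ℍ) :
    ∑' n : ℕ+, (sigma 5 n : ℂ) * cexp (2 * Real.pi * Complex.I * z) ^ (n : ℕ) =
      sigmaSeries 0 (nome z) := by
  have h := summable_sigmaSeries 0 (norm_nome_lt_one z.im_pos)
  have := tsum_zero_pnat_eq_tsum_nat h
  simpa [sigmaSeries, nome] using this

lemma riemannZeta_six : riemannZeta 6 = (Real.pi : ℂ) ^ 6 / 945 := by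
  have h := riemannZeta_two_mul_nat (k := 3) (by norm_num)
  have hb : bernoulli 6 = 1 / 42 := by decide +kernel
  norm_num [hb, Nat.factorial] at h
  rw [h]
  ring

/-- The constant `8π⁶/27` relating `g₃` to `E₆ = 1 - 504 ∑ σ₅(n) qⁿ`. -/
lemma g3_eq (τ : ℍ) :
    g3 τ = 8 * Real.pi ^ 6 / 27 * (1 - 504 * sigmaSeries 0 (nome τ)) := by
  have h := tsum_eisSummand_eq_tsum_sigma_mul_cexp_pow (k := 6) (by norm_num) (by decide) τ
  simp only [Nat.cast_ofNat, Nat.add_one_sub_one, tsum_pnat_sigmaSeries] at h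
  have h2 : ∑' v : Fin 2 → ℤ, EisensteinSeries.eisSummand 6 v τ = (tauPeriods τ).G 6 := by
    rw [PeriodPair.G, tsum_tauPeriods_lattice τ (fun l ↦ (l ^ 6)⁻¹),
      ← (finTwoArrowEquiv ℤ).symm.tsum_eq]
    refine tsum_congr fun p ↦ ?_
    simp [EisensteinSeries.eisSummand, zpow_neg]
  rw [g3, PeriodPair.g₃, ← h2, h, riemannZeta_six]
  have h3 : (-2 * Real.pi * Complex.I : ℂ) ^ 6 = -64 * Real.pi ^ 6 := by
    rw [mul_pow, mul_pow, show (6 : ℕ) = 2 * 3 by norm_num, pow_mul Complex.I, I_sq]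
    ring
  rw [h3]
  norm_num [Nat.factorial]
  ring

lemma E₆_eq (τ : ℍ) : ModularForm.E₆ τ = 1 - 504 * sigmaSeries 0 (nome τ) := by
  have h := EisensteinSeries.q_expansion_bernoulli (k := 6) (by norm_num) (by decide) τ
  have hb : bernoulli 6 = 1 / 42 := by decide +kernel
  simp only [zpow_natCast, Nat.add_one_sub_one, tsum_pnat_sigmaSeries] at h
  rw [h, hb]
  norm_num

lemma g2_eq (τ : ℍ) : g2 τ = 4 * Real.pi ^ 4 / 3 * ModularForm.E₄ τ := by
  have h := tsum_eisSummand_eq_tsum_sigma_mul_cexp_pow (k := 4) (by norm_num) (by decide) τ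
  have h' := EisensteinSeries.q_expansion_riemannZeta (k := 4) (by norm_num) (by decide) τ
  have h2 : ∑' v : Fin 2 → ℤ, EisensteinSeries.eisSummand 4 v τ = (tauPeriods τ).G 4 := by
    rw [PeriodPair.G, tsum_tauPeriods_lattice τ (fun l ↦ (l ^ 4)⁻¹),
      ← (finTwoArrowEquiv ℤ).symm.tsum_eq]
    refine tsum_congr fun p ↦ ?_
    simp [EisensteinSeries.eisSummand, zpow_neg]
  simp only [Nat.cast_ofNat, Nat.add_one_sub_one, zpow_natCast, riemannZeta_four] at h h'
  rw [g2, PeriodPair.g₂, ← h2, h, h']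
  have : (Real.pi : ℂ) ≠ 0 := by exact_mod_cast Real.pi_ne_zero
  field_simp
  ring

lemma eta1_eq (τ : ℍ) : eta1 τ = Real.pi ^ 2 / 3 * EisensteinSeries.E2 τ := by
  have : (Real.pi : ℂ) ≠ 0 := by exact_mod_cast Real.pi_ne_zero
  rw [eta1_eq_G2, EisensteinSeries.E2, Pi.smul_apply, smul_eq_mul, riemannZeta_two]
  field_simp
  ring

open Function UpperHalfPlane in
/-- A function given by a `q`-series tends to the constant coefficient at the cusp. -/
lemma tendsto_atImInfty_of_hasSum_qExpansion {f : ℍ → ℂ} {c : ℕ → ℂ}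
    (hf : ∀ τ : ℍ, HasSum (fun m ↦ c m • Periodic.qParam 1 τ ^ m) (f τ)) :
    Tendsto f atImInfty (𝓝 (c 0)) := by
  have hb : Summable fun m ↦ ‖c m • Periodic.qParam 1 (UpperHalfPlane.I : ℍ) ^ m‖ :=
    (hf UpperHalfPlane.I).summable.norm
  have hq := qParam_tendsto_atImInfty one_pos
  have key := tendsto_tsum_of_dominated_convergence (𝓕 := atImInfty) hb
    (f := fun (τ : ℍ) m ↦ c m • Periodic.qParam 1 τ ^ m) (g := fun m ↦ c m • (0 : ℂ) ^ m)
    (fun m ↦ (hq.pow m).const_smul (c m)) ?_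
  · rw [tsum_eq_single 0 (fun m hm ↦ by simp [hm])] at key
    simp only [pow_zero, smul_eq_mul, mul_one] at key
    exact key.congr fun τ ↦ (hf τ).tsum_eq
  · filter_upwards [(atImInfty_mem _).mpr ⟨1, fun z hz ↦ hz⟩] with τ hτ m
    rw [norm_smul, norm_smul, norm_pow, norm_pow]
    gcongr
    rw [Periodic.norm_qParam, Periodic.norm_qParam]
    apply Real.exp_le_exp.mpr
    have h1 : (1 : ℝ) ≤ τ.im := hτ
    have := mul_le_mul_of_nonneg_left h1 Real.pi_pos.le
    simp only [coe_I, Complex.I_im, UpperHalfPlane.coe_im, div_one]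
    linarith

lemma D_E₆_eq (τ : ℍ) :
    Derivative.normalizedDerivOfComplex ModularForm.E₆ τ = -504 * sigmaSeries 1 (nome τ) := by
  have h : HasDerivAt ((ModularForm.E₆ : ℍ → ℂ) ∘ ofComplex)
      (-(504 * (2 * Real.pi * Complex.I * sigmaSeries 1 (nome τ)))) τ := by
    refine (((hasDerivAt_sigmaSeries_nome 0 τ.im_pos).const_mul 504).const_sub
      1).congr_of_eventuallyEq ?_
    filter_upwards [isOpen_upperHalfPlaneSet.mem_nhds τ.im_pos] with w hw
    rw [Function.comp_apply, ofComplex_apply_of_im_pos hw, E₆_eq]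
  rw [Derivative.normalizedDerivOfComplex, h.deriv]
  have : (Real.pi : ℂ) ≠ 0 := by exact_mod_cast Real.pi_ne_zero
  field_simp

lemma qParam_one_eq_nome (z : ℂ) : Function.Periodic.qParam 1 z = nome z := by
  simp [Function.Periodic.qParam, nome]

open scoped MatrixGroups ModularForm Manifold in
/-- Ramanujan's identity `D E₆ = (E₂E₆ - E₄²)/2`: the difference is a cusp form of weight `8`. -/
lemma ramanujan_E₆ (τ : ℍ) :
    -504 * sigmaSeries 1 (nome τ) =
      (EisensteinSeries.E2 τ * ModularForm.E₆ τ - ModularForm.E₄ τ ^ 2) / 2 := by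
  let G : ℍ → ℂ := Derivative.serreDerivative (6 : ℤ) ModularForm.E₆ +
    (1 / 2 : ℂ) • ((ModularForm.E₄ : ℍ → ℂ) * (ModularForm.E₄ : ℍ → ℂ))
  have hE4 : ∀ γ : SL(2, ℤ), (ModularForm.E₄ : ℍ → ℂ) ∣[(4 : ℤ)] γ = ModularForm.E₄ := fun γ ↦
    SlashInvariantFormClass.slash_action_eq ModularForm.E₄ γ ⟨γ, rfl⟩
  have hE6 : ∀ γ : SL(2, ℤ), (ModularForm.E₆ : ℍ → ℂ) ∣[(6 : ℤ)] γ = ModularForm.E₆ := fun γ ↦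
    SlashInvariantFormClass.slash_action_eq ModularForm.E₆ γ ⟨γ, rfl⟩
  have hG : ∀ γ : SL(2, ℤ), G ∣[(8 : ℤ)] γ = G := by
    intro γ
    have h1 := Derivative.serreDerivative_slash_invariant (k := 6)
      (ModularFormClass.holo ModularForm.E₆) (hE6 γ)
    have h2 := ModularForm.mul_slash_SL2 4 4 γ (ModularForm.E₄ : ℍ → ℂ) ModularForm.E₄
    rw [hE4] at h2
    norm_num at h2
    rw [show (6 : ℤ) + 2 = 8 by norm_num] at h1
    simp only [G, SlashAction.add_slash, ModularForm.SL_smul_slash]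
    rw [h1, h2]
  have hlim : IsZeroAtImInfty G := by
    have t2 := tendsto_atImInfty_of_hasSum_qExpansion (f := EisensteinSeries.E2)
      (fun τ ↦ by simpa only [qParam_one_eq_nome, nome] using
        EisensteinSeries.hasSum_qExpansion_E2 (z := τ))
    have t4 := tendsto_atImInfty_of_hasSum_qExpansion (fun τ ↦
      ModularForm.hasSum_qExpansion ModularForm.E₄ one_pos one_mem_strictPeriods_SL τ)
    have t6 := tendsto_atImInfty_of_hasSum_qExpansion (fun τ ↦
      ModularForm.hasSum_qExpansion ModularForm.E₆ one_pos one_mem_strictPeriods_SL τ)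
    have tD := tendsto_atImInfty_of_hasSum_qExpansion
      (f := Derivative.normalizedDerivOfComplex ModularForm.E₆)
      (c := fun n : ℕ ↦ -504 * ((n : ℂ) ^ 1 * (sigma 5 n : ℂ))) (fun τ ↦ by
        rw [D_E₆_eq, qParam_one_eq_nome]
        refine ((summable_sigmaSeries 1 (norm_nome_lt_one τ.im_pos)).hasSum.mul_left
          (-504)).congr_fun ?_
        intro n
        simp [mul_assoc])
    rw [EisensteinSeries.E_qExpansion_coeff_zero _ (by decide)] at t4 t6
    simp only [if_true, CharP.cast_eq_zero, pow_one, zero_mul, mul_zero] at t2 tD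
    have := (tD.sub ((t2.mul t6).const_mul (6 * 12⁻¹))).add ((t4.mul t4).const_mul (1 / 2))
    norm_num at this
    refine this.congr fun τ ↦ ?_
    simp [G]
    ring
  let F : CuspForm 𝒮ℒ 8 :=
    { toFun := G
      slash_action_eq' := fun _ ⟨γ, hγ⟩ ↦ hγ ▸ hG γ
      holo' := by
        refine (Derivative.serreDerivative_mdifferentiable _
          (ModularFormClass.holo ModularForm.E₆)).add ?_
        exact ((ModularFormClass.holo ModularForm.E₄).mul
          (ModularFormClass.holo ModularForm.E₄)).const_smul _
      zero_at_cusps' := fun {c} hc ↦ by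
        rw [OnePoint.isZeroAt_iff_forall_SL2Z hc]
        intro γ _
        rw [hG]
        exact hlim }
  have hF : F = 0 := rank_zero_iff_forall_zero.mp
    (CuspForm.rank_eq_zero_of_weight_lt_twelve (by norm_num)) F
  have h0 : G τ = 0 := congrArg (fun f : CuspForm 𝒮ℒ 8 ↦ f τ) hF
  simp only [G, Pi.add_apply, Derivative.serreDerivative_apply, Pi.smul_apply, Pi.mul_apply,
    smul_eq_mul, D_E₆_eq] at h0
  push_cast at h0
  linear_combination h0

/-- Ramanujan's identity eliminates `E₄²` and `E₂` together, leaving only `E₆'` and `E₆`. -/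
lemma fC_eq (C : ℝ) (τ : ℍ) :
    fC C τ = 1792 * Real.pi ^ 8 * ((C : ℂ) - τ) * sigmaSeries 1 (nome τ) -
      32 / 3 * Complex.I * Real.pi ^ 7 * (1 - 504 * sigmaSeries 0 (nome τ)) := by
  have h := ramanujan_E₆ τ
  rw [E₆_eq] at h
  rw [fC, eta2_eq, eta1_eq, g2_eq, g3_eq]
  linear_combination (32 / 9 * Real.pi ^ 8 * ((C : ℂ) - τ)) * h

lemma hasDerivAt_g3 (τ : ℍ) :
    HasDerivAt (fun z : ℂ ↦ g3 (ofComplex z))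
      (8 * Real.pi ^ 6 / 27 * (-(504 * (2 * Real.pi * Complex.I * sigmaSeries 1 (nome τ))))) τ := by
  refine ((((hasDerivAt_sigmaSeries_nome 0 τ.im_pos).const_mul 504).const_sub
      1).const_mul _).congr_of_eventuallyEq ?_
  filter_upwards [isOpen_upperHalfPlaneSet.mem_nhds τ.im_pos] with w hw
  rw [ofComplex_apply_of_im_pos hw, g3_eq]

lemma derivH_g3_eq_zero_iff (τ : ℍ) : derivH g3 τ = 0 ↔ sigmaSeries 1 (nome τ) = 0 := by
  have : (Real.pi : ℂ) ≠ 0 := by exact_mod_cast Real.pi_ne_zero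
  rw [derivH, (hasDerivAt_g3 τ).deriv]
  simp [this]

/-! ### The equivariant function `h` and the pencil spanned by `E₆'` and `zE₆' + 6E₆` -/

/-- The Eisenstein series `E₆` as a function on `ℂ`, meaningful on the upper half-plane. -/
def eisSix (z : ℂ) : ℂ := 1 - 504 * sigmaSeries 0 (nome z)

/-- A multiple of the derivative of `E₆`: `E₆'(z) = -1008πi · eisSixDeriv z`. -/
def eisSixDeriv (z : ℂ) : ℂ := sigmaSeries 1 (nome z)

/-- The equivariant function `h = z + 6 E₆/E₆'`. -/
def equivariantH (z : ℂ) : ℂ := z + Complex.I * eisSix z / (168 * Real.pi * eisSixDeriv z)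

/-- The pencil of functions which, off the zeros of `E₆'`, vanish exactly where `h = A / B`.
It is spanned by `E₆'` and `zE₆' + 6E₆`. -/
def pencil (A B : ℝ) (z : ℂ) : ℂ :=
  168 * Real.pi * eisSixDeriv z * (A - B * z) - B * (Complex.I * eisSix z)

lemma pi_ne_zero' : (Real.pi : ℂ) ≠ 0 := by exact_mod_cast Real.pi_ne_zero

lemma hasDerivAt_eisSix {z : ℂ} (hz : 0 < z.im) :
    HasDerivAt eisSix (-(1008 * Real.pi * Complex.I * eisSixDeriv z)) z := by
  refine (((hasDerivAt_sigmaSeries_nome 0 hz).const_mul 504).const_sub 1).congr_deriv ?_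
  simp only [eisSixDeriv]
  ring

lemma hasDerivAt_eisSixDeriv {z : ℂ} (hz : 0 < z.im) :
    HasDerivAt eisSixDeriv (2 * Real.pi * Complex.I * sigmaSeries 2 (nome z)) z :=
  hasDerivAt_sigmaSeries_nome 1 hz

lemma im_neg_inv_pos {z : ℂ} (hz : 0 < z.im) : 0 < (-z⁻¹).im := by
  have h0 : z ≠ 0 := by rintro rfl; simp at hz
  rw [neg_im, inv_im, neg_div, neg_neg]
  exact div_pos hz (normSq_pos.mpr h0)

open scoped MatrixGroups ModularForm in
lemma eisSix_neg_inv {z : ℂ} (hz : 0 < z.im) : eisSix (-z⁻¹) = z ^ 6 * eisSix z := by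
  have h0 : z ≠ 0 := by rintro rfl; simp at hz
  have h : (ModularForm.E₆ : ℍ → ℂ) ∣[(6 : ℤ)] ModularGroup.S = ModularForm.E₆ :=
    SlashInvariantFormClass.slash_action_eq ModularForm.E₆ ModularGroup.S ⟨_, rfl⟩
  have h1 := congrFun h ⟨z, hz⟩
  rw [ModularForm.SL_slash_apply, UpperHalfPlane.modular_S_smul, E₆_eq, E₆_eq] at h1
  have h2 : denom ModularGroup.S z = z := by
    have := ModularGroup.denom_S (⟨z, hz⟩ : ℍ)
    exact this
  simp only [h2, inv_neg] at h1
  rw [eisSix, eisSix, ← h1, zpow_neg]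
  field_simp

/-- The derivative of the modular transformation law of `E₆`. -/
lemma eisSixDeriv_neg_inv {z : ℂ} (hz : 0 < z.im) :
    168 * Real.pi * eisSixDeriv (-z⁻¹) =
      z ^ 7 * (168 * Real.pi * eisSixDeriv z * z + Complex.I * eisSix z) := by
  have h0 : z ≠ 0 := by rintro rfl; simp at hz
  have h1 : HasDerivAt (fun w ↦ eisSix (-w⁻¹))
      (-(1008 * Real.pi * Complex.I * eisSixDeriv (-z⁻¹)) * (z ^ 2)⁻¹) z := by
    have h5 : HasDerivAt (fun w : ℂ ↦ -w⁻¹) (z ^ 2)⁻¹ z := by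
      simpa using (hasDerivAt_inv h0).fun_neg
    exact HasDerivAt.comp (h₂ := eisSix) z (hasDerivAt_eisSix (im_neg_inv_pos hz)) h5
  have h2 : HasDerivAt (fun w ↦ w ^ 6 * eisSix w)
      (6 * z ^ 5 * eisSix z + z ^ 6 * -(1008 * Real.pi * Complex.I * eisSixDeriv z)) z := by
    simpa using (hasDerivAt_pow 6 z).fun_mul (hasDerivAt_eisSix hz)
  have h3 : (fun w ↦ eisSix (-w⁻¹)) =ᶠ[𝓝 z] fun w ↦ w ^ 6 * eisSix w := by
    filter_upwards [isOpen_upperHalfPlaneSet.mem_nhds hz] with w hw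
    exact eisSix_neg_inv hw
  have h4 := (h2.congr_of_eventuallyEq h3).unique h1
  obtain ⟨e, he⟩ : ∃ e, e = eisSixDeriv (-z⁻¹) := ⟨_, rfl⟩
  rw [← he] at h4 ⊢
  field_simp at h4
  have hI : Complex.I * Complex.I = -1 := I_mul_I
  linear_combination (-Complex.I / 6) * h4 +
    (168 * Real.pi * e - 168 * Real.pi * z ^ 8 * eisSixDeriv z) * hI

lemma pencil_neg_inv (A B : ℝ) {z : ℂ} (hz : 0 < z.im) :
    pencil A B (-z⁻¹) = z ^ 7 * pencil B (-A) z := by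
  have h0 : z ≠ 0 := by rintro rfl; simp at hz
  rw [pencil, eisSixDeriv_neg_inv hz, eisSix_neg_inv hz, pencil]
  push_cast
  field_simp
  ring

lemma eisSix_add_one (z : ℂ) : eisSix (z + 1) = eisSix z := by
  simp [eisSix, nome_add_one]

lemma eisSixDeriv_add_one (z : ℂ) : eisSixDeriv (z + 1) = eisSixDeriv z := by
  simp [eisSixDeriv, nome_add_one]

lemma pencil_add_one (A B : ℝ) (z : ℂ) : pencil A B (z + 1) = pencil (A - B) B z := by
  rw [pencil, eisSix_add_one, eisSixDeriv_add_one, pencil]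
  push_cast
  ring

/-- Transformation under the order three rotation `z ↦ 1/(1 - z)`. -/
lemma pencil_rotate (A B : ℝ) {z : ℂ} (hz : 0 < z.im) :
    pencil A B (1 / (1 - z)) = (z - 1) ^ 7 * pencil (B - A) (-A) z := by
  have h1 : 0 < (z - 1).im := by simpa using hz
  have h2 : (1 : ℂ) / (1 - z) = -(z - 1)⁻¹ := by
    rw [one_div, ← neg_sub z 1, inv_neg]
  have h3 := pencil_add_one (B - A) (-A) (z - 1)
  rw [sub_add_cancel, sub_neg_eq_add, sub_add_cancel] at h3
  rw [h2, pencil_neg_inv A B h1, h3]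

lemma pencil_rotate_symm (A B : ℝ) {z : ℂ} (hz : 0 < z.im) :
    pencil A B (1 - 1 / z) = z ^ 7 * pencil B (B - A) z := by
  rw [show (1 : ℂ) - 1 / z = -z⁻¹ + 1 by rw [one_div]; ring, pencil_add_one,
    pencil_neg_inv _ _ hz, neg_sub]

lemma pencil_eq_mul {A B : ℝ} {z : ℂ} (h : eisSixDeriv z ≠ 0) :
    pencil A B z = 168 * Real.pi * eisSixDeriv z * (A - B * equivariantH z) := by
  have := pi_ne_zero'
  rw [pencil, equivariantH]
  field_simp
  ring

lemma eisSix_conj (z : ℂ) : eisSix (-(starRingEnd ℂ) z) = (starRingEnd ℂ) (eisSix z) := by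
  simp [eisSix, nome_neg_conj, sigmaSeries_conj, Complex.conj_ofNat]

lemma eisSixDeriv_conj (z : ℂ) :
    eisSixDeriv (-(starRingEnd ℂ) z) = (starRingEnd ℂ) (eisSixDeriv z) := by
  simp [eisSixDeriv, nome_neg_conj, sigmaSeries_conj]

lemma equivariantH_neg_conj (z : ℂ) :
    equivariantH (-(starRingEnd ℂ) z) = -(starRingEnd ℂ) (equivariantH z) := by
  rw [equivariantH, eisSix_conj, eisSixDeriv_conj, equivariantH]
  simp [Complex.conj_ofNat]
  ring

lemma equivariantH_add_one (z : ℂ) : equivariantH (z + 1) = equivariantH z + 1 := by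
  rw [equivariantH, eisSix_add_one, eisSixDeriv_add_one, equivariantH]
  ring

lemma equivariantH_one_sub_conj (z : ℂ) :
    equivariantH (1 - (starRingEnd ℂ) z) = 1 - (starRingEnd ℂ) (equivariantH z) := by
  rw [sub_eq_neg_add, equivariantH_add_one, equivariantH_neg_conj, ← sub_eq_neg_add]

/-- Equivariance of `h` under `z ↦ -1/z`. -/
lemma equivariantH_neg_inv {z : ℂ} (hz : 0 < z.im) (h : eisSixDeriv z ≠ 0)
    (h' : eisSixDeriv (-z⁻¹) ≠ 0) : equivariantH (-z⁻¹) * equivariantH z = -1 := by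
  have h0 : z ≠ 0 := by rintro rfl; simp at hz
  have hp := pi_ne_zero'
  have h1 := eisSixDeriv_neg_inv hz
  have e1 : equivariantH z * (168 * Real.pi * eisSixDeriv z) =
      168 * Real.pi * eisSixDeriv z * z + Complex.I * eisSix z := by
    rw [equivariantH]
    field_simp
  have e2 : equivariantH (-z⁻¹) * (168 * Real.pi * eisSixDeriv (-z⁻¹)) =
      -(168 * Real.pi * eisSixDeriv (-z⁻¹) * z⁻¹) + Complex.I * eisSix (-z⁻¹) := by
    rw [equivariantH, add_mul, div_mul_cancel₀ _ (by simp [hp, h'])]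
    ring
  rw [← e1] at h1
  have hH : equivariantH z ≠ 0 := by
    intro h2
    rw [h2] at h1
    simp [hp, h'] at h1
  rw [h1, eisSix_neg_inv hz] at e2
  have e3 : equivariantH (-z⁻¹) * equivariantH z * (z ^ 7 * (168 * Real.pi * eisSixDeriv z)) =
      -1 * (z ^ 7 * (168 * Real.pi * eisSixDeriv z)) := by
    have : z ^ 7 * z⁻¹ = z ^ 6 := by field_simp
    linear_combination e2 - (equivariantH z * (168 * Real.pi * eisSixDeriv z)) * this -
      z ^ 6 * e1
  exact mul_right_cancel₀ (by simp [h0, hp, h]) e3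

/-- On the unit circle `-1/z = -z̄`, which forces `|h| = 1`. -/
lemma norm_equivariantH_of_norm_eq_one {z : ℂ} (hz : 0 < z.im) (h : eisSixDeriv z ≠ 0)
    (hn : ‖z‖ = 1) : ‖equivariantH z‖ = 1 := by
  have h1 : -z⁻¹ = -(starRingEnd ℂ) z := by
    rw [inv_eq_conj hn]
  have h2 := equivariantH_neg_inv hz h (by rw [h1, eisSixDeriv_conj]; simpa using h)
  rw [h1, equivariantH_neg_conj] at h2
  have h3 := congrArg norm h2
  rw [norm_mul, norm_neg, norm_neg, RCLike.norm_conj, norm_one] at h3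
  nlinarith [norm_nonneg (equivariantH z)]

/-- Since `h' = 7 - 6 E₆E₆''/E₆'²`, the estimates below concern `E₆E₆''/E₆'²`. -/
lemma hasDerivAt_equivariantH {z : ℂ} (hz : 0 < z.im) (h : eisSixDeriv z ≠ 0) :
    HasDerivAt equivariantH
      (7 + eisSix z * sigmaSeries 2 (nome z) / (84 * eisSixDeriv z ^ 2)) z := by
  have hp := pi_ne_zero'
  have h1 := (hasDerivAt_id z).add ((((hasDerivAt_eisSix hz).const_mul Complex.I)).div
    ((hasDerivAt_eisSixDeriv hz).const_mul (168 * Real.pi : ℂ)) (by simp [hp, h]))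
  refine h1.congr_deriv ?_
  have hI : Complex.I ^ 2 = -1 := I_sq
  field_simp
  linear_combination (-84672 * eisSixDeriv z ^ 2 - 2 * 84 * eisSix z * sigmaSeries 2 (nome z)) * hI

lemma fC_eq_pencil (C : ℝ) (τ : ℍ) : fC C τ = 32 / 3 * Real.pi ^ 7 * pencil C 1 τ := by
  rw [fC_eq, pencil, eisSix, eisSixDeriv]
  push_cast
  ring

lemma differentiableOn_pencil (A B : ℝ) :
    DifferentiableOn ℂ (pencil A B) upperHalfPlaneSet := fun z hz ↦ by
  have h1 := (hasDerivAt_eisSix hz).differentiableAt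
  have h2 := (hasDerivAt_eisSixDeriv hz).differentiableAt
  exact (DifferentiableAt.sub ((h2.const_mul _).mul (by fun_prop))
    ((h1.const_mul _).const_mul _)).differentiableWithinAt

lemma isSimpleZero_fC {C : ℝ} {τ : ℍ} (h0 : pencil C 1 τ = 0) (h1 : deriv (pencil C 1) τ ≠ 0) :
    IsSimpleZero (fC C) τ := by
  have hp := pi_ne_zero'
  have he : (fun z : ℂ ↦ fC C (ofComplex z)) =ᶠ[𝓝 (τ : ℂ)]
      fun z ↦ 32 / 3 * Real.pi ^ 7 * pencil C 1 z := by
    filter_upwards [isOpen_upperHalfPlaneSet.mem_nhds τ.im_pos] with w hw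
    rw [ofComplex_apply_of_im_pos hw, fC_eq_pencil]
  have hd : DifferentiableOn ℂ (fun z ↦ 32 / 3 * Real.pi ^ 7 * pencil C 1 z)
      upperHalfPlaneSet := (differentiableOn_pencil C 1).const_mul _
  have ha := (hd.analyticOnNhd isOpen_upperHalfPlaneSet) τ τ.im_pos
  have h2 := ha.analyticOrderAt_sub_eq_one_of_deriv_ne_zero (by
    rw [deriv_const_mul _ ((differentiableOn_pencil C 1).differentiableAt
      (isOpen_upperHalfPlaneSet.mem_nhds τ.im_pos))]
    simp [hp, h1])
  rw [IsSimpleZero, analyticOrderAt_congr he]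
  simpa [h0] using h2

/-- At a zero of `A - B h`, simplicity is the nonvanishing of `h'`. -/
lemma deriv_pencil_ne_zero {A B : ℝ} (hB : B ≠ 0) {z : ℂ} (hz : 0 < z.im)
    (h : eisSixDeriv z ≠ 0) (h0 : pencil A B z = 0) (h1 : deriv equivariantH z ≠ 0) :
    deriv (pencil A B) z ≠ 0 := by
  have hp := pi_ne_zero'
  have hc : ContinuousAt eisSixDeriv z := (hasDerivAt_eisSixDeriv hz).continuousAt
  have he : pencil A B =ᶠ[𝓝 z]
      fun w ↦ 168 * Real.pi * eisSixDeriv w * (A - B * equivariantH w) := by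
    filter_upwards [hc.eventually_ne h] with w hw using pencil_eq_mul hw
  rw [pencil_eq_mul h] at h0
  have h2 : (A - B * equivariantH z : ℂ) = 0 := by simpa [hp, h] using h0
  have hH := (hasDerivAt_equivariantH hz h).differentiableAt.hasDerivAt
  have hd := (((hasDerivAt_eisSixDeriv hz).const_mul (168 * Real.pi : ℂ)).mul
    ((hH.const_mul (B : ℂ)).const_sub (A : ℂ)))
  rw [(hd.congr_of_eventuallyEq he).deriv, h2]
  simp [hp, h, h1, hB]

/-- Nonvanishing of the derivative of a pencil member at a zero passes through a change of
variables. -/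
lemma deriv_ne_zero_of_comp {f g φ u : ℂ → ℂ} {z : ℂ} (hf : DifferentiableAt ℂ f (φ z))
    (hφ : DifferentiableAt ℂ φ z) (hu : DifferentiableAt ℂ u z) (hg : DifferentiableAt ℂ g z)
    (he : (fun w ↦ f (φ w)) =ᶠ[𝓝 z] fun w ↦ u w * g w) (hu0 : u z ≠ 0) (hg0 : g z = 0)
    (hg1 : deriv g z ≠ 0) : deriv f (φ z) ≠ 0 := by
  intro h
  have h1 := (hf.hasDerivAt.comp z hφ.hasDerivAt)
  have h2 := (hu.hasDerivAt.mul hg.hasDerivAt).congr_of_eventuallyEq he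
  have h3 := h1.unique h2
  rw [h, hg0] at h3
  simp [hu0, hg1] at h3

/-! ### Estimates for the `q`-series of `E₆/E₆'` and `E₆E₆''/E₆'²` -/

/-- A bound `M` for the value and a bound `K` for the imaginary part relative to that of `q`.
A power series with real coefficients satisfies such bounds; the second one makes it possible to
divide by `Im q`, uniformly up to the real axis. -/
def Tame (q : ℂ) (M K : ℝ) (w : ℂ) : Prop := ‖w‖ ≤ M ∧ |w.im| ≤ K * |q.im|

namespace Tame

variable {q w v : ℂ} {M K M' K' : ℝ}

lemma mono (h : Tame q M K w) (hM : M ≤ M') (hK : K ≤ K') : Tame q M' K' w :=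
  ⟨h.1.trans hM, h.2.trans (by gcongr)⟩

lemma ofNat (n : ℕ) [n.AtLeastTwo] : Tame q (OfNat.ofNat n) 0 (OfNat.ofNat n) := by
  simp [Tame]

lemma one : Tame q 1 0 1 := by simp [Tame]

lemma self (h : ‖q‖ ≤ M) : Tame q M 1 q := ⟨h, by simp⟩

lemma add (h : Tame q M K w) (h' : Tame q M' K' v) : Tame q (M + M') (K + K') (w + v) :=
  ⟨(norm_add_le _ _).trans (add_le_add h.1 h'.1), by
    rw [add_im, add_mul]
    exact (abs_add_le _ _).trans (add_le_add h.2 h'.2)⟩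

lemma neg (h : Tame q M K w) : Tame q M K (-w) := by
  simpa [Tame] using h

lemma sub (h : Tame q M K w) (h' : Tame q M' K' v) : Tame q (M + M') (K + K') (w - v) := by
  rw [sub_eq_add_neg]
  exact h.add h'.neg

lemma mul (h : Tame q M K w) (h' : Tame q M' K' v) :
    Tame q (M * M') (M * K' + K * M') (w * v) := by
  have hM : 0 ≤ M := (norm_nonneg _).trans h.1
  have hK : 0 ≤ K * |q.im| := (abs_nonneg _).trans h.2
  refine ⟨(norm_mul_le _ _).trans (mul_le_mul h.1 h'.1 (norm_nonneg _) hM), ?_⟩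
  rw [mul_im]
  refine (abs_add_le _ _).trans ?_
  rw [abs_mul, abs_mul, add_mul]
  refine add_le_add ?_ ?_
  · rw [mul_assoc]
    exact mul_le_mul ((abs_re_le_norm _).trans h.1) h'.2 (abs_nonneg _) hM
  · rw [mul_right_comm]
    exact mul_le_mul h.2 ((abs_re_le_norm _).trans h'.1) (abs_nonneg _) hK

lemma inv {m : ℝ} (hm : 0 < m) (hw : m ≤ ‖w‖) (h : Tame q M K w) :
    Tame q m⁻¹ (K / m ^ 2) w⁻¹ := by
  refine ⟨by rw [norm_inv]; gcongr, ?_⟩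
  have hK : 0 ≤ K * |q.im| := (abs_nonneg _).trans h.2
  rw [inv_im, abs_div, abs_neg, abs_of_nonneg (normSq_nonneg w), normSq_eq_norm_sq,
    div_mul_eq_mul_div]
  exact div_le_div₀ hK h.2 (by positivity) (by gcongr)

end Tame

lemma abs_im_pow_le (q : ℂ) (n : ℕ) : |(q ^ n).im| * ‖q‖ ≤ n * ‖q‖ ^ n * |q.im| := by
  induction n with
  | zero => simp
  | succ n ih =>
    rw [pow_succ, mul_im]
    have h1 : |(q ^ n).re| ≤ ‖q‖ ^ n := (abs_re_le_norm _).trans (norm_pow _ _).le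
    have h2 : |q.re| ≤ ‖q‖ := abs_re_le_norm _
    calc |(q ^ n).re * q.im + (q ^ n).im * q.re| * ‖q‖
        ≤ (|(q ^ n).re| * |q.im| + |(q ^ n).im| * |q.re|) * ‖q‖ := by
          rw [← abs_mul, ← abs_mul]
          gcongr
          exact abs_add_le _ _
      _ ≤ (‖q‖ ^ n * |q.im| + |(q ^ n).im| * ‖q‖) * ‖q‖ := by gcongr
      _ = ‖q‖ ^ (n + 1) * |q.im| + (|(q ^ n).im| * ‖q‖) * ‖q‖ := by ring
      _ ≤ ‖q‖ ^ (n + 1) * |q.im| + (n * ‖q‖ ^ n * |q.im|) * ‖q‖ := by gcongr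
      _ = _ := by push_cast; ring

lemma tame_tsum {a : ℕ → ℝ} {A B : ℝ} (ha : ∀ n, |a n| ≤ A * B ^ n) (hB : 0 ≤ B) {q : ℂ}
    (hq0 : q ≠ 0) (hq : B * ‖q‖ < 1) :
    Tame q (A / (1 - B * ‖q‖)) (A * B / (1 - B * ‖q‖) ^ 2) (∑' n, (a n : ℂ) * q ^ n) := by
  have hr : 0 < ‖q‖ := norm_pos_iff.mpr hq0
  have hs0 : 0 ≤ B * ‖q‖ := by positivity
  have hn : ∀ n, ‖(a n : ℂ) * q ^ n‖ ≤ A * (B * ‖q‖) ^ n := fun n ↦ by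
    rw [norm_mul, norm_pow, Complex.norm_real, Real.norm_eq_abs, mul_pow, ← mul_assoc]
    gcongr
    exact ha n
  have hsum := (hasSum_geometric_of_lt_one hs0 hq).mul_left A
  have hsm : Summable fun n ↦ (a n : ℂ) * q ^ n := Summable.of_norm_bounded hsum.summable hn
  refine ⟨tsum_of_norm_bounded hsum hn, ?_⟩
  have him : HasSum (fun n ↦ ((a n : ℂ) * q ^ n).im) (∑' n, (a n : ℂ) * q ^ n).im :=
    hasSum_im hsm.hasSum
  have hsum2 := (hasSum_coe_mul_geometric_of_norm_lt_one (r := B * ‖q‖)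
    (by rwa [Real.norm_of_nonneg hs0])).mul_left (A / ‖q‖ * |q.im|)
  have := tsum_of_norm_bounded hsum2 (f := fun n ↦ ((a n : ℂ) * q ^ n).im) fun n ↦ ?_
  · rw [him.tsum_eq, Real.norm_eq_abs] at this
    refine this.trans (le_of_eq ?_)
    field_simp
  · rw [im_ofReal_mul, Real.norm_eq_abs, abs_mul]
    have h1 := abs_im_pow_le q n
    rw [← le_div_iff₀ hr] at h1
    have h0 : 0 ≤ A * B ^ n := (abs_nonneg _).trans (ha n)
    calc |a n| * |(q ^ n).im| ≤ (A * B ^ n) * (n * ‖q‖ ^ n * |q.im| / ‖q‖) := by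
          gcongr
          exact ha n
      _ = _ := by rw [mul_pow]; ring

/-- The tail `∑ (n+4)ᵏ σ₅(n+4) qⁿ` of `sigmaSeries k`. -/
def sigmaTail (k : ℕ) (q : ℂ) : ℂ :=
  ∑' n : ℕ, ((((n + 4 : ℕ) : ℝ) ^ k * (sigma 5 (n + 4) : ℝ) : ℝ) : ℂ) * q ^ n

lemma sigmaSeries_eq_add_tail (k : ℕ) {q : ℂ} (hq : ‖q‖ < 1) :
    sigmaSeries k q = q + 2 ^ k * 33 * q ^ 2 + 3 ^ k * 244 * q ^ 3 + q ^ 4 * sigmaTail k q := by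
  have h := (summable_sigmaSeries k hq).sum_add_tsum_nat_add 4
  have h2 : sigma 5 2 = 33 := by decide +kernel
  have h0 : sigma 5 0 = 0 := by simp
  have h3 : sigma 5 3 = 244 := by decide +kernel
  rw [sigmaSeries, ← h]
  simp only [Finset.sum_range_succ, Finset.sum_range_zero, h0, h2, h3, sigma_one]
  have : ∑' n : ℕ, ((n + 4 : ℕ) : ℂ) ^ k * (sigma 5 (n + 4) : ℂ) * q ^ (n + 4) =
      q ^ 4 * sigmaTail k q := by
    rw [sigmaTail, ← tsum_mul_left]
    refine tsum_congr fun n ↦ ?_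
    push_cast
    ring
  rw [this]
  push_cast
  ring

lemma tame_sigmaTail {k : ℕ} (hk : k ≤ 2) {q : ℂ} (hq0 : q ≠ 0) (hq : ‖q‖ ≤ 1 / 228) :
    Tame q (4 ^ (k + 6) * 1.03) (4 ^ (k + 6) * 6.4) (sigmaTail k q) := by
  have ha : ∀ n : ℕ, |((n + 4 : ℕ) : ℝ) ^ k * (sigma 5 (n + 4) : ℝ)| ≤ 4 ^ (k + 6) * 6 ^ n := by
    intro n
    rw [abs_of_nonneg (by positivity)]
    have h1 : (sigma 5 (n + 4) : ℝ) ≤ ((n + 4 : ℕ) : ℝ) ^ 6 := by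
      exact_mod_cast sigma_le_pow_succ 5 (n + 4)
    have h2 : ((n + 4 : ℕ) : ℝ) ≤ 4 * (5 / 4) ^ n := by
      have := one_add_mul_le_pow (a := (1 / 4 : ℝ)) (by norm_num) n
      norm_num at this ⊢
      linarith
    have h3 : ((5 / 4 : ℝ) ^ (k + 6)) ≤ 6 := by
      calc (5 / 4 : ℝ) ^ (k + 6) ≤ (5 / 4) ^ 8 := pow_le_pow_right₀ (by norm_num) (by omega)
        _ ≤ 6 := by norm_num
    calc ((n + 4 : ℕ) : ℝ) ^ k * (sigma 5 (n + 4) : ℝ)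
        ≤ ((n + 4 : ℕ) : ℝ) ^ k * ((n + 4 : ℕ) : ℝ) ^ 6 := by gcongr
      _ = ((n + 4 : ℕ) : ℝ) ^ (k + 6) := by rw [pow_add]
      _ ≤ (4 * (5 / 4) ^ n) ^ (k + 6) := by gcongr
      _ = 4 ^ (k + 6) * ((5 / 4) ^ (k + 6)) ^ n := by
        rw [mul_pow, ← pow_mul, ← pow_mul, mul_comm n]
      _ ≤ 4 ^ (k + 6) * 6 ^ n := by gcongr
  have h6 : 6 * ‖q‖ ≤ 1 / 38 := by linarith
  have h37 : (37 / 38 : ℝ) ≤ 1 - 6 * ‖q‖ := by linarith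
  refine (tame_tsum ha (by norm_num) hq0 (by linarith)).mono ?_ ?_
  · rw [div_le_iff₀ (by linarith), mul_assoc]
    exact le_mul_of_one_le_right (by positivity) (by linarith)
  · rw [div_le_iff₀ (by positivity), mul_assoc]
    gcongr
    nlinarith

/-- The unit part `P` of the `q`-series of `E₆'`. -/
def derivUnit (q : ℂ) : ℂ := 1 + 66 * q + q ^ 2 * (732 + q * sigmaTail 1 q)

/-- The second order remainder of the `q`-series of `E₆`. -/
def eisRem (q : ℂ) : ℂ := -16632 - 122976 * q - 504 * (q * (q * sigmaTail 0 q))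

/-- The unit part `Q` of the `q`-series of `E₆''`. -/
def derivTwoUnit (q : ℂ) : ℂ := 1 + 132 * q + q ^ 2 * (2196 + q * sigmaTail 2 q)

lemma sigmaSeries_one_eq {q : ℂ} (hq : ‖q‖ < 1) : sigmaSeries 1 q = q * derivUnit q := by
  rw [sigmaSeries_eq_add_tail 1 hq, derivUnit]
  ring

lemma sigmaSeries_two_eq {q : ℂ} (hq : ‖q‖ < 1) : sigmaSeries 2 q = q * derivTwoUnit q := by
  rw [sigmaSeries_eq_add_tail 2 hq, derivTwoUnit]
  ring

lemma one_sub_sigmaSeries_zero_eq {q : ℂ} (hq : ‖q‖ < 1) :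
    1 - 504 * sigmaSeries 0 q = 1 - 504 * q + q ^ 2 * eisRem q := by
  rw [sigmaSeries_eq_add_tail 0 hq, eisRem]
  ring

lemma norm_derivUnit_ge {q : ℂ} (hq0 : q ≠ 0) {ρ : ℝ} (hq : ‖q‖ ≤ ρ) (hρ : ρ ≤ 1 / 228) :
    1 - 66 * ρ - 810 * ρ ^ 2 ≤ ‖derivUnit q‖ := by
  have hT := (tame_sigmaTail (k := 1) (by norm_num) hq0 (hq.trans hρ)).1
  have hq1 : ‖q‖ ≤ 1 / 228 := hq.trans hρ
  have h1 : ‖66 * q + q ^ 2 * (732 + q * sigmaTail 1 q)‖ ≤ 66 * ρ + ρ ^ 2 * 810 := by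
    refine (norm_add_le _ _).trans (add_le_add ?_ ?_)
    · rw [norm_mul, Complex.norm_ofNat]
      gcongr
    · rw [norm_mul, norm_pow]
      gcongr
      refine (norm_add_le _ _).trans ?_
      rw [norm_mul, Complex.norm_ofNat]
      have : ‖q‖ * ‖sigmaTail 1 q‖ ≤ 1 / 228 * (4 ^ (1 + 6) * 1.03) := by gcongr
      norm_num at this ⊢
      linarith
  have h2 : derivUnit q = 1 - -(66 * q + q ^ 2 * (732 + q * sigmaTail 1 q)) := by
    rw [derivUnit]
    ring
  rw [h2]
  have := norm_sub_norm_le (1 : ℂ) (-(66 * q + q ^ 2 * (732 + q * sigmaTail 1 q)))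
  rw [norm_one, norm_neg] at this
  linarith

lemma derivUnit_ne_zero {q : ℂ} (hq0 : q ≠ 0) (hq : ‖q‖ ≤ 1 / 228) : derivUnit q ≠ 0 := by
  have := norm_derivUnit_ge hq0 hq le_rfl
  exact norm_pos_iff.mp (lt_of_lt_of_le (by norm_num) this)

/-- The function `X` in `E₆ / (q P) = 1/q - 570 + q (20256 + q X) / P`. -/
def quotRem (q : ℂ) : ℂ :=
  294264 - sigmaTail 1 q - 504 * (q * sigmaTail 0 q) + 570 * (q * sigmaTail 1 q)

lemma eis_div_deriv_eq {q : ℂ} (hq0 : q ≠ 0) (hq : ‖q‖ ≤ 1 / 228) :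
    (1 - 504 * sigmaSeries 0 q) / sigmaSeries 1 q =
      q⁻¹ - 570 + q * (20256 + q * quotRem q) * (derivUnit q)⁻¹ := by
  have hq1 : ‖q‖ < 1 := by linarith
  have hP := derivUnit_ne_zero hq0 hq
  rw [one_sub_sigmaSeries_zero_eq hq1, sigmaSeries_one_eq hq1]
  field_simp
  rw [derivUnit, eisRem, quotRem]
  ring

lemma tame_quotRem {q : ℂ} (hq0 : q ≠ 0) (hq : ‖q‖ ≤ 1 / 228) :
    Tame q (20256 + 1600) 500000 (20256 + q * quotRem q) := by
  have h0 := tame_sigmaTail (k := 0) (by norm_num) hq0 hq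
  have h1 := tame_sigmaTail (k := 1) (by norm_num) hq0 hq
  have hs := Tame.self (q := q) hq
  have hX := ((((Tame.ofNat 294264).sub h1).sub ((Tame.ofNat 504).mul (hs.mul h0))).add
    ((Tame.ofNat 570).mul (hs.mul h1)))
  have := (Tame.ofNat (q := q) 20256).add (hs.mul hX)
  refine this.mono ?_ ?_ <;> norm_num

/-- Bound for the error term in `E₆ / (q P) = 1/q - 570 + ⋯`. -/
lemma norm_quot_error_le {q : ℂ} (hq0 : q ≠ 0) {ρ m : ℝ} (hq : ‖q‖ ≤ ρ) (hρ : ρ ≤ 1 / 228)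
    (hm : 0 < m) (hm' : m ≤ 1 - 66 * ρ - 810 * ρ ^ 2) :
    ‖q * (20256 + q * quotRem q) * (derivUnit q)⁻¹‖ ≤ ρ * 21856 / m := by
  have h1 := (tame_quotRem hq0 (hq.trans hρ)).1
  have h2 := norm_derivUnit_ge hq0 hq hρ
  rw [norm_mul, norm_mul, norm_inv, ← div_eq_mul_inv]
  have : 0 ≤ ρ := (norm_nonneg q).trans hq
  norm_num at h1
  gcongr
  linarith

lemma tame_derivUnit {q : ℂ} (hq0 : q ≠ 0) (hq : ‖q‖ ≤ 1 / 390) :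
    Tame q 1.18 71 (derivUnit q) := by
  have h1 := tame_sigmaTail (k := 1) (by norm_num) hq0 (hq.trans (by norm_num))
  have hs := Tame.self (q := q) hq
  have := (Tame.one.add ((Tame.ofNat 66).mul hs)).add
    ((hs.mul hs).mul ((Tame.ofNat 732).add (hs.mul h1)))
  rw [derivUnit, pow_two]
  refine this.mono ?_ ?_ <;> norm_num

lemma tame_inv_derivUnit {q : ℂ} (hq0 : q ≠ 0) (hq : ‖q‖ ≤ 1 / 390) :
    Tame q 1.22 106 (derivUnit q)⁻¹ := by
  have h := norm_derivUnit_ge hq0 hq (by norm_num)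
  refine ((tame_derivUnit hq0 hq).inv (m := 0.825) (by norm_num) (by norm_num at h ⊢; linarith)
    ).mono ?_ ?_ <;> norm_num

/-- Since `Im (1/q) = -Im q / |q|²`, a tame error of size below `|q|⁻²` cannot change the sign of
the imaginary part of `1/q`. -/
lemma im_inv_add_neg {q w : ℂ} {M : ℝ} (hw : Tame q M (390 ^ 2 - 1) w) (hq : ‖q‖ ≤ 1 / 390)
    (him : 0 < q.im) : (q⁻¹ + w).im < 0 := by
  have hq0 : q ≠ 0 := by rintro rfl; simp at him
  have hr : 0 < ‖q‖ := norm_pos_iff.mpr hq0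
  have h1 := (le_abs_self _).trans hw.2
  rw [abs_of_pos him] at h1
  rw [add_im, inv_im, normSq_eq_norm_sq]
  have h2 : 390 ^ 2 * q.im ≤ q.im / ‖q‖ ^ 2 := by
    rw [le_div_iff₀ (by positivity), mul_right_comm]
    have h3 : 390 * ‖q‖ ≤ 1 := by linarith
    have h4 : 390 ^ 2 * ‖q‖ ^ 2 ≤ 1 := by
      rw [← mul_pow]
      exact pow_le_one₀ (by positivity) h3
    exact mul_le_of_le_one_left him.le h4
  rw [neg_div]
  linarith

lemma im_eis_div_deriv_neg {q : ℂ} (hq : ‖q‖ ≤ 1 / 390) (him : 0 < q.im) :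
    ((1 - 504 * sigmaSeries 0 q) / sigmaSeries 1 q).im < 0 := by
  have hq0 : q ≠ 0 := by rintro rfl; simp at him
  have hq' : ‖q‖ ≤ 1 / 228 := hq.trans (by norm_num)
  rw [eis_div_deriv_eq hq0 hq', sub_add_eq_add_sub, add_sub_assoc]
  have hs := Tame.self (q := q) hq
  have h := ((hs.mul (tame_quotRem hq0 hq')).mul (tame_inv_derivUnit hq0 hq)).sub
    (Tame.ofNat 570)
  exact im_inv_add_neg (h.mono le_rfl (by norm_num)) hq him

/-- The function `E` in `E₆ Q / (q P²) = 1/q - 504 + q E / P²`. -/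
def derivQuotRem (q : ℂ) : ℂ :=
  eisRem q * (1 + 132 * q) + (2196 + q * sigmaTail 2 q) * (1 - 504 * q) +
    q * q * (eisRem q * (2196 + q * sigmaTail 2 q)) -
    (4356 + 2 * ((1 + 66 * q) * (732 + q * sigmaTail 1 q)) +
      q * q * ((732 + q * sigmaTail 1 q) * (732 + q * sigmaTail 1 q))) * (1 - 504 * q)

lemma eis_mul_derivTwo_eq {q : ℂ} (hq0 : q ≠ 0) (hq : ‖q‖ ≤ 1 / 228) :
    (1 - 504 * sigmaSeries 0 q) * sigmaSeries 2 q / sigmaSeries 1 q ^ 2 =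
      q⁻¹ - 504 + q * derivQuotRem q * ((derivUnit q)⁻¹ * (derivUnit q)⁻¹) := by
  have hq1 : ‖q‖ < 1 := by linarith
  have hP := derivUnit_ne_zero hq0 hq
  rw [one_sub_sigmaSeries_zero_eq hq1, sigmaSeries_one_eq hq1, sigmaSeries_two_eq hq1]
  field_simp
  rw [derivUnit, derivTwoUnit, derivQuotRem]
  ring

lemma im_eis_mul_derivTwo_neg {q : ℂ} (hq : ‖q‖ ≤ 1 / 390) (him : 0 < q.im) :
    ((1 - 504 * sigmaSeries 0 q) * sigmaSeries 2 q / sigmaSeries 1 q ^ 2).im < 0 := by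
  have hq0 : q ≠ 0 := by rintro rfl; simp at him
  have hq' : ‖q‖ ≤ 1 / 228 := hq.trans (by norm_num)
  rw [eis_mul_derivTwo_eq hq0 hq', sub_add_eq_add_sub, add_sub_assoc]
  have h0 := tame_sigmaTail (k := 0) (by norm_num) hq0 hq'
  have h1 := tame_sigmaTail (k := 1) (by norm_num) hq0 hq'
  have h2 := tame_sigmaTail (k := 2) (by norm_num) hq0 hq'
  have hs := Tame.self (q := q) hq
  have hN : Tame q 16962 134300 (eisRem q) := by
    have := (((Tame.ofNat (q := q) 16632).neg).sub ((Tame.ofNat 122976).mul hs)).sub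
      ((Tame.ofNat 504).mul (hs.mul (hs.mul h0)))
    exact this.mono (by norm_num) (by norm_num)
  have hQ : Tame q 2370 68700 (2196 + q * sigmaTail 2 q) :=
    ((Tame.ofNat 2196).add (hs.mul h2)).mono (by norm_num) (by norm_num)
  have hP : Tame q 776 17150 (732 + q * sigmaTail 1 q) :=
    ((Tame.ofNat 732).add (hs.mul h1)).mono (by norm_num) (by norm_num)
  have h504 : Tame q 2.293 504 (1 - 504 * q) :=
    (Tame.one.sub ((Tame.ofNat 504).mul hs)).mono (by norm_num) (by norm_num)
  have h132 : Tame q 1.339 132 (1 + 132 * q) :=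
    (Tame.one.add ((Tame.ofNat 132).mul hs)).mono (by norm_num) (by norm_num)
  have h66 : Tame q 1.17 66 (1 + 66 * q) :=
    (Tame.one.add ((Tame.ofNat 66).mul hs)).mono (by norm_num) (by norm_num)
  have hE : Tame q 43000 7500000 (derivQuotRem q) := by
    have := (((hN.mul h132).add (hQ.mul h504)).add ((hs.mul hs).mul (hN.mul hQ))).sub
      ((((Tame.ofNat 4356).add ((Tame.ofNat 2).mul (h66.mul hP))).add
        ((hs.mul hs).mul (hP.mul hP))).mul h504)
    exact this.mono (by norm_num) (by norm_num)
  have hi := tame_inv_derivUnit hq0 hq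
  have h := ((hs.mul hE).mul (hi.mul hi)).sub (Tame.ofNat 504)
  exact im_inv_add_neg (h.mono le_rfl (by norm_num)) hq him

/-! ### Signs of `h` and `h'` on the left half of the fundamental domain -/

lemma exp_five_gt : (148.4 : ℝ) < Real.exp 5 := by
  have h := Real.exp_one_gt_d9
  have h2 : Real.exp 5 = Real.exp 1 ^ 5 := by rw [← Real.exp_nat_mul]; norm_num
  rw [h2]
  calc (148.4 : ℝ) < 2.7182818283 ^ 5 := by norm_num
    _ < _ := by gcongr

/-- Numerical lower bounds for `1/|q|`, through `e⁵ > 148.4` and the quadratic Taylor polynomial. -/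
lemma le_exp_of_le {a b y : ℝ} (ha : 0 ≤ a) (hy : 5 + 2 * a ≤ 2 * Real.pi * y)
    (hb : b ≤ 148.4 * (1 + a + a ^ 2 / 2) ^ 2) : b ≤ Real.exp (2 * Real.pi * y) := by
  have h1 := Real.quadratic_le_exp_of_nonneg ha
  calc b ≤ 148.4 * (1 + a + a ^ 2 / 2) ^ 2 := hb
    _ ≤ Real.exp 5 * Real.exp a ^ 2 := by
      have := exp_five_gt.le
      gcongr
    _ = Real.exp (5 + 2 * a) := by rw [← Real.exp_nat_mul, ← Real.exp_add]; norm_num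
    _ ≤ _ := Real.exp_le_exp.mpr hy

lemma exp_ge_228 {y : ℝ} (hy : 0.866 ≤ y) : 228 ≤ Real.exp (2 * Real.pi * y) :=
  le_exp_of_le (a := 0.2205) (by norm_num) (by nlinarith [Real.pi_gt_d4]) (by norm_num)

lemma exp_ge_280 {y : ℝ} (hy : 0.9 ≤ y) : 280 ≤ Real.exp (2 * Real.pi * y) :=
  le_exp_of_le (a := 0.327) (by norm_num) (by nlinarith [Real.pi_gt_d4]) (by norm_num)

/-- A linear lower bound for `exp (2πy)`, sharp near `y = 0.95`. -/
lemma exp_ge_linear {y : ℝ} (hy : 0.95 ≤ y) :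
    390 + 390 * (2 * Real.pi * (y - 0.95)) ≤ Real.exp (2 * Real.pi * y) := by
  have h1 : (390 : ℝ) ≤ Real.exp (2 * Real.pi * 0.95) := by
    have h := Real.exp_one_gt_d9
    have h6 : (403.4 : ℝ) ≤ Real.exp 6 := by
      have h2 : Real.exp 6 = Real.exp 1 ^ 6 := by rw [← Real.exp_nat_mul]; norm_num
      rw [h2]
      calc (403.4 : ℝ) ≤ 2.7182818283 ^ 6 := by norm_num
        _ ≤ _ := by gcongr
    have h3 := Real.add_one_le_exp (-0.03115 : ℝ)
    calc (390 : ℝ) ≤ 403.4 * (-0.03115 + 1) := by norm_num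
      _ ≤ Real.exp 6 * Real.exp (-0.03115) := by gcongr
      _ = Real.exp (6 + -0.03115) := (Real.exp_add _ _).symm
      _ ≤ _ := Real.exp_le_exp.mpr (by nlinarith [Real.pi_gt_d4])
  have h2 := Real.add_one_le_exp (2 * Real.pi * (y - 0.95))
  have h3 : 0 ≤ 2 * Real.pi * (y - 0.95) :=
    mul_nonneg (by positivity) (by linarith)
  calc 390 + 390 * (2 * Real.pi * (y - 0.95)) = 390 * (2 * Real.pi * (y - 0.95) + 1) := by ring
    _ ≤ Real.exp (2 * Real.pi * 0.95) * Real.exp (2 * Real.pi * (y - 0.95)) := by gcongr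
    _ = _ := by rw [← Real.exp_add]; ring_nf

lemma exp_ge_390 {y : ℝ} (hy : 0.95 ≤ y) : 390 ≤ Real.exp (2 * Real.pi * y) := by
  have := exp_ge_linear hy
  have h3 : 0 ≤ 2 * Real.pi * (y - 0.95) :=
    mul_nonneg (by positivity) (by linarith)
  linarith

lemma norm_nome_le {z : ℂ} {b : ℝ} (hb : 0 < b) (h : b ≤ Real.exp (2 * Real.pi * z.im)) :
    ‖nome z‖ ≤ 1 / b := by
  rw [norm_nome, neg_mul, neg_mul, Real.exp_neg, one_div]
  gcongr

lemma nome_im (z : ℂ) :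
    (nome z).im = Real.exp (-2 * Real.pi * z.im) * Real.sin (2 * Real.pi * z.re) := by
  rw [nome, Complex.exp_im]
  simp

lemma nome_im_pos {z : ℂ} (h0 : 0 < z.re) (h1 : z.re < 1 / 2) : 0 < (nome z).im := by
  rw [nome_im]
  have := Real.pi_pos
  exact mul_pos (Real.exp_pos _) (Real.sin_pos_of_pos_of_lt_pi (by positivity) (by nlinarith))

lemma nome_inv_re (z : ℂ) :
    ((nome z)⁻¹).re = Real.exp (2 * Real.pi * z.im) * Real.cos (2 * Real.pi * z.re) := by
  rw [nome, ← Complex.exp_neg, Complex.exp_re]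
  simp

lemma equivariantH_eq (z : ℂ) :
    equivariantH z = z + ((168 * Real.pi : ℝ) : ℂ)⁻¹ *
      (Complex.I * ((1 - 504 * sigmaSeries 0 (nome z)) / sigmaSeries 1 (nome z))) := by
  rw [equivariantH, eisSix, eisSixDeriv]
  push_cast
  rw [mul_div_assoc', mul_comm (_⁻¹), ← div_eq_mul_inv, div_div]
  ring_nf

lemma equivariantH_re (z : ℂ) : (equivariantH z).re = z.re - (168 * Real.pi)⁻¹ *
    ((1 - 504 * sigmaSeries 0 (nome z)) / sigmaSeries 1 (nome z)).im := by
  rw [equivariantH_eq, add_re, ← ofReal_inv, re_ofReal_mul, I_mul_re]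
  ring

lemma equivariantH_im (z : ℂ) : (equivariantH z).im = z.im + (168 * Real.pi)⁻¹ *
    ((1 - 504 * sigmaSeries 0 (nome z)) / sigmaSeries 1 (nome z)).re := by
  rw [equivariantH_eq, add_im, ← ofReal_inv, im_ofReal_mul, I_mul_im]

/-- The constant `0.866` is just below `√3/2`, the least height on the fundamental domain. -/
lemma eisSixDeriv_ne_zero {z : ℂ} (hy : 0.866 ≤ z.im) : eisSixDeriv z ≠ 0 := by
  have h := norm_nome_le (z := z) (by norm_num) (exp_ge_228 hy)
  rw [eisSixDeriv, sigmaSeries_one_eq (norm_nome_lt_one (by linarith))]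
  exact mul_ne_zero (nome_ne_zero z) (derivUnit_ne_zero (nome_ne_zero z) h)

lemma equivariantH_re_pos {z : ℂ} (h0 : 0 < z.re) (h1 : z.re < 1 / 2) (hy : 0.95 ≤ z.im) :
    0 < (equivariantH z).re := by
  have h := im_eis_div_deriv_neg (norm_nome_le (by norm_num) (exp_ge_390 hy))
    (nome_im_pos h0 h1)
  rw [equivariantH_re]
  have h2 : 0 < (168 * Real.pi)⁻¹ := by positivity
  nlinarith

lemma equivariantH_deriv_im_neg {z : ℂ} (h0 : 0 < z.re) (h1 : z.re < 1 / 2)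
    (hy : 0.95 ≤ z.im) : (deriv equivariantH z).im < 0 := by
  have h := im_eis_mul_derivTwo_neg (norm_nome_le (by norm_num) (exp_ge_390 hy))
    (nome_im_pos h0 h1)
  rw [(hasDerivAt_equivariantH (by linarith) (eisSixDeriv_ne_zero (by linarith))).deriv]
  have h2 : (7 + eisSix z * sigmaSeries 2 (nome z) / (84 * eisSixDeriv z ^ 2) : ℂ) =
      ((7 : ℝ) : ℂ) + ((84⁻¹ : ℝ) : ℂ) * ((1 - 504 * sigmaSeries 0 (nome z)) *
        sigmaSeries 2 (nome z) / sigmaSeries 1 (nome z) ^ 2) := by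
    rw [eisSix, eisSixDeriv]
    push_cast
    ring
  rw [h2, add_im, ofReal_im, im_ofReal_mul, zero_add]
  linarith

/-- Here `sigmaSeries 1 q = qP` with `P = derivUnit q`; `Re (E₆/(qP))` agrees with
`Re (1/q) - 570` up to an explicit error. -/
lemma abs_quot_re_le {z : ℂ} {b m : ℝ} (hb : 228 ≤ b)
    (h : b ≤ Real.exp (2 * Real.pi * z.im)) (hm : 0 < m)
    (hm' : m ≤ 1 - 66 * (1 / b) - 810 * (1 / b) ^ 2) :
    |((1 - 504 * sigmaSeries 0 (nome z)) / sigmaSeries 1 (nome z)).re -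
      (Real.exp (2 * Real.pi * z.im) * Real.cos (2 * Real.pi * z.re) - 570)| ≤
        1 / b * 21856 / m := by
  have hq := norm_nome_le (z := z) (by linarith) h
  have hb' : 1 / b ≤ 1 / 228 := by gcongr
  have h1 := norm_quot_error_le (nome_ne_zero z) hq hb' hm hm'
  rw [eis_div_deriv_eq (nome_ne_zero z) (hq.trans hb'), add_re, sub_re, nome_inv_re]
  refine le_trans (le_of_eq ?_) ((abs_re_le_norm _).trans h1)
  congr 1
  simp

/-- `cos` lies below its chord on `[π/2, π]`. -/
lemma cos_le_chord {x : ℝ} (h0 : 1 / 4 ≤ x) (h1 : x ≤ 1 / 2) :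
    Real.cos (2 * Real.pi * x) ≤ -(4 * (x - 1 / 4)) := by
  have hp := Real.pi_pos
  have h := Real.mul_le_sin (x := 2 * Real.pi * (x - 1 / 4))
    (mul_nonneg (by positivity) (by linarith)) (by nlinarith)
  have h2 : Real.cos (2 * Real.pi * x) = -Real.sin (2 * Real.pi * (x - 1 / 4)) := by
    rw [← Real.cos_add_pi_div_two]
    ring_nf
  have h3 : 2 / Real.pi * (2 * Real.pi * (x - 1 / 4)) = 4 * (x - 1 / 4) := by
    field_simp
    ring
  rw [h2]
  linarith

/-- Criterion from `Im h = y + Re (E₆/A)/(168π)`, where `A = ∑ n σ₅(n) qⁿ`. -/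
lemma equivariantH_im_neg_of_re_lt {z : ℂ}
    (h : ((1 - 504 * sigmaSeries 0 (nome z)) / sigmaSeries 1 (nome z)).re <
      -(168 * Real.pi * z.im)) : (equivariantH z).im < 0 := by
  rw [equivariantH_im]
  have h2 : 0 < 168 * Real.pi := by positivity
  have h3 : (168 * Real.pi)⁻¹ * ((1 - 504 * sigmaSeries 0 (nome z)) /
      sigmaSeries 1 (nome z)).re < (168 * Real.pi)⁻¹ * -(168 * Real.pi * z.im) := by gcongr
  have h4 : (168 * Real.pi)⁻¹ * -(168 * Real.pi * z.im) = -z.im := by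
    field_simp
  linarith

/-- In the low part of the left half of the fundamental domain `Im h < 0`. There `Re z` is bounded
away from `1/4`, so `Re (1/q)` is negative; the cut at height `0.9` makes this quantitative. -/
lemma equivariantH_im_neg_of_im_le {z : ℂ} (h0 : 0 ≤ z.re) (h1 : z.re ≤ 1 / 2) (hz : 0 < z.im)
    (hn : 1 ≤ ‖z‖) (hy : z.im ≤ 0.95) : (equivariantH z).im < 0 := by
  have hsq : 1 ≤ z.re ^ 2 + z.im ^ 2 := by
    have := one_le_pow₀ hn (n := 2)
    rwa [← normSq_eq_norm_sq, normSq_apply, ← pow_two, ← pow_two] at this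
  have hp := Real.pi_lt_d4
  have hp' := Real.pi_gt_d4
  have hy1 : 0.866 ≤ z.im := by nlinarith
  apply equivariantH_im_neg_of_re_lt
  rcases le_total z.im 0.9 with hy2 | hy2
  · have hx : 0.435 ≤ z.re := by nlinarith
    have he := exp_ge_228 hy1
    have hc := cos_le_chord (by linarith) h1
    have h2 := (abs_le.mp (abs_quot_re_le (m := 0.69) le_rfl he (by norm_num) (by norm_num))).2
    have h3 : Real.exp (2 * Real.pi * z.im) * Real.cos (2 * Real.pi * z.re) ≤ 228 * -0.74 := by
      nlinarith
    norm_num at h2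
    nlinarith
  · have hx : 0.312 ≤ z.re := by nlinarith
    have he := exp_ge_280 hy2
    have hc := cos_le_chord (by linarith) h1
    have h2 := (abs_le.mp (abs_quot_re_le (m := 0.75) (by norm_num) he (by norm_num)
      (by norm_num))).2
    have h3 : Real.exp (2 * Real.pi * z.im) * Real.cos (2 * Real.pi * z.re) ≤ 280 * -0.248 := by
      nlinarith
    norm_num at h2
    nlinarith

lemma equivariantH_im_pos_of_re_eq_zero {z : ℂ} (h0 : z.re = 0) (hy : 0.95 ≤ z.im) :
    0 < (equivariantH z).im := by
  have h2 := (abs_le.mp (abs_quot_re_le (m := 0.82) (by norm_num) (exp_ge_390 hy) (by norm_num)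
      (by norm_num))).1
  have he := exp_ge_390 hy
  rw [h0, mul_zero, Real.cos_zero] at h2
  norm_num at h2
  have hp' := Real.pi_gt_d4
  rw [equivariantH_im]
  have h3 : 0 < 168 * Real.pi := by positivity
  have h4 : (168 * Real.pi)⁻¹ * -(168 * Real.pi * z.im) < (168 * Real.pi)⁻¹ *
      ((1 - 504 * sigmaSeries 0 (nome z)) / sigmaSeries 1 (nome z)).re := by
    gcongr
    nlinarith
  have h5 : (168 * Real.pi)⁻¹ * -(168 * Real.pi * z.im) = -z.im := by
    field_simp
  linarith

lemma equivariantH_im_neg_of_re_eq_half {z : ℂ} (h0 : z.re = 1 / 2) (hy : 0.95 ≤ z.im) :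
    (equivariantH z).im < 0 := by
  have h2 := (abs_le.mp (abs_quot_re_le (m := 0.82) (by norm_num) (exp_ge_390 hy) (by norm_num)
      (by norm_num))).2
  have he := exp_ge_linear hy
  rw [h0, show 2 * Real.pi * (1 / 2) = Real.pi by ring, Real.cos_pi] at h2
  norm_num at h2
  have hp := Real.pi_lt_d4
  have hp' := Real.pi_pos
  apply equivariantH_im_neg_of_re_lt
  have h3 : 0 ≤ Real.pi * (z.im - 0.95) := mul_nonneg hp'.le (by linarith)
  nlinarith

lemma norm_equivariantH_ge {z : ℂ} (h0 : 0 ≤ z.re) (h1 : z.re ≤ 1 / 2) (hy : 0.95 ≤ z.im) :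
    (168 * Real.pi)⁻¹ * (Real.exp (2 * Real.pi * z.im) - 640) - (1 / 2 + z.im) ≤
      ‖equivariantH z‖ := by
  have he := exp_ge_390 hy
  have hq := norm_nome_le (z := z) (by norm_num) he
  have h2 := norm_quot_error_le (nome_ne_zero z) hq (by norm_num) (m := 0.82) (by norm_num)
    (by norm_num)
  have hz : ‖z‖ ≤ 1 / 2 + z.im := by
    refine (norm_le_abs_re_add_abs_im z).trans ?_
    rw [abs_of_nonneg h0, abs_of_nonneg (by linarith)]
    linarith
  have hW : Real.exp (2 * Real.pi * z.im) - 640 ≤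
      ‖(1 - 504 * sigmaSeries 0 (nome z)) / sigmaSeries 1 (nome z)‖ := by
    rw [eis_div_deriv_eq (nome_ne_zero z) (hq.trans (by norm_num))]
    have h3 : ‖(nome z)⁻¹‖ = Real.exp (2 * Real.pi * z.im) := by
      rw [norm_inv, norm_nome, ← Real.exp_neg]
      ring_nf
    have h4 := norm_sub_norm_le ((nome z)⁻¹) (570 - nome z * (20256 + nome z *
      quotRem (nome z)) * (derivUnit (nome z))⁻¹)
    have h5 := norm_sub_le (570 : ℂ) (nome z * (20256 + nome z *
      quotRem (nome z)) * (derivUnit (nome z))⁻¹)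
    rw [sub_sub_eq_add_sub, add_sub_right_comm, h3] at h4
    rw [Complex.norm_ofNat] at h5
    have h8 : (1 / 390 * 21856 / 0.82 : ℝ) ≤ 70 := by norm_num
    linarith
  have h6 : ‖((168 * Real.pi : ℝ) : ℂ)⁻¹ * (Complex.I * ((1 - 504 * sigmaSeries 0 (nome z)) /
      sigmaSeries 1 (nome z)))‖ = (168 * Real.pi)⁻¹ *
      ‖(1 - 504 * sigmaSeries 0 (nome z)) / sigmaSeries 1 (nome z)‖ := by
    rw [norm_mul, norm_mul, norm_I, one_mul, norm_inv, Complex.norm_real, Real.norm_of_nonneg]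
    positivity
  rw [equivariantH_eq, add_comm z]
  have h7 := norm_sub_le_norm_add (((168 * Real.pi : ℝ) : ℂ)⁻¹ * (Complex.I *
    ((1 - 504 * sigmaSeries 0 (nome z)) / sigmaSeries 1 (nome z)))) z
  rw [h6] at h7
  have h8 : (168 * Real.pi)⁻¹ * (Real.exp (2 * Real.pi * z.im) - 640) ≤ (168 * Real.pi)⁻¹ *
      ‖(1 - 504 * sigmaSeries 0 (nome z)) / sigmaSeries 1 (nome z)‖ := by gcongr
  linarith

/-! ### The real locus of `h` on the left half of the fundamental domain -/

lemma continuousAt_equivariantH {z : ℂ} (hy : 0.866 ≤ z.im) : ContinuousAt equivariantH z :=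
  (hasDerivAt_equivariantH (by linarith) (eisSixDeriv_ne_zero hy)).continuousAt

/-- Since `Im h' < 0`, the function `Im (h · conj (w - z))` decreases strictly along the segment
from `z` to `w`. -/
lemma im_equivariantH_mul_conj_lt {z w : ℂ} (hzw : z ≠ w) (hz : 0.95 ≤ z.im) (hw : 0.95 ≤ w.im)
    (h0 : ∀ t ∈ Set.Ioo (0 : ℝ) 1, 0 < (z + t * (w - z)).re ∧ (z + t * (w - z)).re < 1 / 2) :
    (equivariantH w * (starRingEnd ℂ) (w - z)).im <
      (equivariantH z * (starRingEnd ℂ) (w - z)).im := by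
  have him : ∀ t ∈ Set.Icc (0 : ℝ) 1, 0.95 ≤ (z + t * (w - z)).im := fun t ht ↦ by
    have : (z + t * (w - z)).im = (1 - t) * z.im + t * w.im := by simp; ring
    rw [this]
    nlinarith [ht.1, ht.2]
  have hd : ∀ t ∈ Set.Icc (0 : ℝ) 1, HasDerivAt
      (fun t : ℝ ↦ (equivariantH (z + t * (w - z)) * (starRingEnd ℂ) (w - z)).im)
      (deriv equivariantH (z + t * (w - z)) * (w - z) * (starRingEnd ℂ) (w - z)).im t := by
    intro t ht
    have h1 := him t ht
    have h2 := (hasDerivAt_equivariantH (z := z + t * (w - z)) (by linarith)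
      (eisSixDeriv_ne_zero (by linarith))).differentiableAt.hasDerivAt
    have h3 : HasDerivAt (fun t : ℝ ↦ z + t * (w - z)) (w - z) t := by
      simpa using ((Complex.ofRealCLM.hasDerivAt (x := t)).mul_const (w - z)).const_add z
    have h4 := (h2.comp t h3).mul_const ((starRingEnd ℂ) (w - z))
    exact (Complex.imCLM.hasFDerivAt.comp_hasDerivAt t h4)
  have hs := strictAntiOn_of_deriv_neg (convex_Icc (0 : ℝ) 1)
    (fun t ht ↦ (hd t ht).continuousAt.continuousWithinAt) (fun t ht ↦ by
      rw [interior_Icc] at ht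
      rw [(hd t (Set.Ioo_subset_Icc_self ht)).deriv, mul_assoc, mul_conj, mul_comm,
        im_ofReal_mul]
      exact mul_neg_of_pos_of_neg (normSq_pos.mpr (sub_ne_zero.mpr hzw.symm))
        (equivariantH_deriv_im_neg (h0 t ht).1 (h0 t ht).2
          (him t (Set.Ioo_subset_Icc_self ht))))
  have := hs (Set.left_mem_Icc.mpr zero_le_one) (Set.right_mem_Icc.mpr zero_le_one) zero_lt_one
  simpa using this

lemma equivariantH_injective {z w : ℂ} (hz0 : 0 < z.re) (hz1 : z.re < 1 / 2) (hz : 0.95 ≤ z.im)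
    (hw0 : 0 < w.re) (hw1 : w.re < 1 / 2) (hw : 0.95 ≤ w.im)
    (h : equivariantH z = equivariantH w) : z = w := by
  by_contra hzw
  refine (im_equivariantH_mul_conj_lt hzw hz hw fun t ht ↦ ?_).ne (by rw [h])
  have : (z + t * (w - z)).re = (1 - t) * z.re + t * w.re := by simp; ring
  rw [this]
  constructor <;> nlinarith [ht.1, ht.2]

lemma im_equivariantH_strictAntiOn {y : ℝ} (hy : 0.95 ≤ y) :
    StrictAntiOn (fun x : ℝ ↦ (equivariantH (x + y * Complex.I)).im) (Set.Icc 0 (1 / 2)) := by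
  intro a ha b hb hab
  have h := im_equivariantH_mul_conj_lt (z := a + y * Complex.I) (w := b + y * Complex.I)
    (fun h ↦ hab.ne (by simpa using h)) (by simpa using hy) (by simpa using hy) (fun t ht ↦ by
      have : ((a + y * Complex.I : ℂ) + t * ((b + y * Complex.I) - (a + y * Complex.I))).re =
        (1 - t) * a + t * b := by simp; ring
      rw [this]
      constructor <;> nlinarith [ht.1, ht.2, ha.1, hb.2])
  have e : (starRingEnd ℂ) ((b + y * Complex.I : ℂ) - (a + y * Complex.I)) = ((b - a : ℝ) : ℂ) := by
    simp
  rw [e, im_mul_ofReal, im_mul_ofReal] at h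
  exact lt_of_mul_lt_mul_right h (by linarith)

/-- Above height `0.95`, the curve `Im h = 0` in the left half-strip is a continuous graph over
the imaginary axis. -/
lemma exists_real_curve : ∃ X : ℝ → ℝ, ContinuousOn X (Set.Ici 0.95) ∧ ∀ y ≥ 0.95,
    0 < X y ∧ X y < 1 / 2 ∧ (equivariantH (X y + y * Complex.I)).im = 0 ∧
    ∀ x : ℝ, 0 ≤ x → x ≤ 1 / 2 → (equivariantH (x + y * Complex.I)).im = 0 → x = X y := by
  have hex : ∀ y : ℝ, ∃ x : ℝ, 0.95 ≤ y → 0 < x ∧ x < 1 / 2 ∧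
      (equivariantH (x + y * Complex.I)).im = 0 := by
    intro y
    by_cases hy : 0.95 ≤ y
    · have hc : ContinuousOn (fun x : ℝ ↦ (equivariantH (x + y * Complex.I)).im)
          (Set.Icc 0 (1 / 2)) := fun x _ ↦ by
        have h1 : ContinuousAt equivariantH (x + y * Complex.I) :=
          continuousAt_equivariantH (by simp; linarith)
        exact (continuous_im.continuousAt.comp (h1.comp (f := fun x : ℝ ↦ (x + y * Complex.I : ℂ))
          (by fun_prop))).continuousWithinAt
      obtain ⟨x, hx, hx0⟩ := intermediate_value_Ioo' (by norm_num) hc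
        (Set.mem_Ioo.mpr ⟨equivariantH_im_neg_of_re_eq_half (by simp) (by simpa using hy),
          equivariantH_im_pos_of_re_eq_zero (by simp) (by simpa using hy)⟩)
      exact ⟨x, fun _ ↦ ⟨hx.1, hx.2, hx0⟩⟩
    · exact ⟨0, fun h ↦ absurd h hy⟩
  choose X hX using hex
  refine ⟨X, fun y hy ↦ ?_, fun y hy ↦ ⟨(hX y hy).1, (hX y hy).2.1, (hX y hy).2.2,
    fun x h0 h1 h ↦ (im_equivariantH_strictAntiOn hy).injOn ⟨h0, h1⟩
      ⟨(hX y hy).1.le, (hX y hy).2.1.le⟩ (h.trans (hX y hy).2.2.symm)⟩⟩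
  have hc : ∀ a : ℝ, ContinuousAt (fun y : ℝ ↦ (equivariantH (a + y * Complex.I)).im) y :=
    fun a ↦ by
      have h1 : ContinuousAt equivariantH (a + y * Complex.I) :=
        continuousAt_equivariantH (by simp; have : (0.95 : ℝ) ≤ y := hy; linarith)
      exact continuous_im.continuousAt.comp
        (h1.comp (f := fun y : ℝ ↦ (a + y * Complex.I : ℂ)) (by fun_prop))
  have hlt : ∀ y' : ℝ, 0.95 ≤ y' → ∀ a ∈ Set.Icc (0 : ℝ) (1 / 2),
      (a < X y' ↔ 0 < (equivariantH (a + y' * Complex.I)).im) ∧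
      (X y' < a ↔ (equivariantH (a + y' * Complex.I)).im < 0) := fun y' hy' a ha ↦ by
    have hm : X y' ∈ Set.Icc (0 : ℝ) (1 / 2) := ⟨(hX y' hy').1.le, (hX y' hy').2.1.le⟩
    rw [← (im_equivariantH_strictAntiOn hy').lt_iff_gt ha hm,
      ← (im_equivariantH_strictAntiOn hy').lt_iff_gt hm ha]
    simp only [(hX y' hy').2.2, and_self]
  refine tendsto_order.mpr ⟨fun a ha ↦ ?_, fun a ha ↦ ?_⟩
  · rcases lt_or_ge a 0 with h | h
    · filter_upwards [self_mem_nhdsWithin] with y' hy' using h.trans (hX y' hy').1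
    · have hm : a ∈ Set.Icc (0 : ℝ) (1 / 2) := ⟨h, (ha.trans (hX y hy).2.1).le⟩
      filter_upwards [self_mem_nhdsWithin, ((hc a).eventually_const_lt
        (((hlt y hy a hm).1).mp ha)).filter_mono nhdsWithin_le_nhds] with y' hy' h2
      exact ((hlt y' hy' a hm).1).mpr h2
  · rcases lt_or_ge (1 / 2) a with h | h
    · filter_upwards [self_mem_nhdsWithin] with y' hy' using (hX y' hy').2.1.trans h
    · have hm : a ∈ Set.Icc (0 : ℝ) (1 / 2) := ⟨((hX y hy).1.trans ha).le, h⟩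
      filter_upwards [self_mem_nhdsWithin, ((hc a).eventually_lt_const
        (((hlt y hy a hm).2).mp ha)).filter_mono nhdsWithin_le_nhds] with y' hy' h2
      exact ((hlt y' hy' a hm).2).mpr h2

lemma exists_large_norm_equivariantH {M : ℝ} (hM : 0 ≤ M) {z : ℂ} (h0 : 0 ≤ z.re)
    (h1 : z.re ≤ 1 / 2) (hy : M + 100 ≤ z.im) : M < ‖equivariantH z‖ := by
  refine lt_of_lt_of_le ?_ (norm_equivariantH_ge h0 h1 (by linarith))
  have hp := Real.pi_gt_three
  have hp' := Real.pi_lt_d4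
  have h2 := Real.quadratic_le_exp_of_nonneg (x := 2 * Real.pi * z.im)
    (mul_nonneg (by positivity) (by linarith))
  have h3 : 6 * z.im ≤ 2 * Real.pi * z.im := by nlinarith
  have h4 : 17 * z.im ^ 2 ≤ Real.exp (2 * Real.pi * z.im) - 640 := by
    have h7 : (6 * z.im) ^ 2 ≤ (2 * Real.pi * z.im) ^ 2 :=
      pow_le_pow_left₀ (by linarith) h3 2
    nlinarith
  have h5 : (540 : ℝ)⁻¹ ≤ (168 * Real.pi)⁻¹ := inv_anti₀ (by positivity) (by linarith)
  have h6 : (540 : ℝ)⁻¹ * (17 * z.im ^ 2) ≤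
      (168 * Real.pi)⁻¹ * (Real.exp (2 * Real.pi * z.im) - 640) := by gcongr
  nlinarith

lemma normSq_add_mul_I' (x y : ℝ) : ‖(x + y * Complex.I : ℂ)‖ ^ 2 = x ^ 2 + y ^ 2 := by
  rw [← normSq_eq_norm_sq, normSq_add_mul_I]

/-- On the curve `Im h = 0` one passes from the inside of the unit disc to its outside at a single
height `y₁`, where `h = 1`; above it `h > 1`, and `h` takes all these values. -/
lemma exists_height : ∃ X : ℝ → ℝ, ∃ y₁ : ℝ, 0.95 ≤ y₁ ∧
    (∀ y ≥ 0.95, 0 < X y ∧ X y < 1 / 2 ∧ (equivariantH (X y + y * Complex.I)).im = 0 ∧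
      ∀ x : ℝ, 0 ≤ x → x ≤ 1 / 2 → (equivariantH (x + y * Complex.I)).im = 0 → x = X y) ∧
    (‖(X y₁ + y₁ * Complex.I : ℂ)‖ = 1 ∧ (equivariantH (X y₁ + y₁ * Complex.I)).re = 1) ∧
    (∀ y ≥ 0.95, y < y₁ → ‖(X y + y * Complex.I : ℂ)‖ < 1) ∧
    (∀ y > y₁, 1 < ‖(X y + y * Complex.I : ℂ)‖ ∧
      1 < (equivariantH (X y + y * Complex.I)).re) ∧
    ∀ C ≥ (1 : ℝ), ∃ y ≥ y₁, (equivariantH (X y + y * Complex.I)).re = C := by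
  obtain ⟨X, hXc, hX⟩ := exists_real_curve
  have hzc : ContinuousOn (fun y : ℝ ↦ (X y + y * Complex.I : ℂ)) (Set.Ici 0.95) :=
    (continuous_ofReal.comp_continuousOn hXc).add (by fun_prop)
  obtain ⟨φ, hφ⟩ : ∃ φ : ℝ → ℝ, φ = fun y ↦ (equivariantH (X y + y * Complex.I)).re := ⟨_, rfl⟩
  obtain ⟨ψ, hψ⟩ : ∃ ψ : ℝ → ℝ, ψ = fun y ↦ ‖(X y + y * Complex.I : ℂ)‖ := ⟨_, rfl⟩
  have hψc : ContinuousOn ψ (Set.Ici 0.95) := hψ ▸ hzc.norm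
  have hφc : ContinuousOn φ (Set.Ici 0.95) := by
    rw [hφ]
    refine continuous_re.comp_continuousOn fun y hy ↦ ?_
    have h1 : ContinuousAt equivariantH (X y + y * Complex.I) :=
      continuousAt_equivariantH (by simp; have : (0.95 : ℝ) ≤ y := hy; linarith)
    exact ContinuousAt.comp_continuousWithinAt (f := fun y : ℝ ↦ (X y + y * Complex.I : ℂ)) h1
      (hzc y hy)
  have hval : ∀ y ≥ 0.95, equivariantH (X y + y * Complex.I) = φ y := fun y hy ↦
    Complex.ext (by simp [hφ]) (by simpa using (hX y hy).2.2.1)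
  have hφ0 : ∀ y ≥ 0.95, 0 < φ y := fun y hy ↦ by
    rw [hφ]
    exact equivariantH_re_pos (by simpa using (hX y hy).1) (by simpa using (hX y hy).2.1)
      (by simpa using hy)
  have hinj : ∀ a ≥ 0.95, ∀ b ≥ 0.95, φ a = φ b → a = b := fun a ha b hb h ↦ by
    have := equivariantH_injective (z := X a + a * Complex.I) (w := X b + b * Complex.I)
      (by simpa using (hX a ha).1) (by simpa using (hX a ha).2.1) (by simpa using ha)
      (by simpa using (hX b hb).1) (by simpa using (hX b hb).2.1) (by simpa using hb)
      (by rw [hval a ha, hval b hb, h])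
    simpa using congrArg Complex.im this
  have hone : ∀ y ≥ 0.95, ψ y = 1 → φ y = 1 := fun y hy h ↦ by
    have h1 := norm_equivariantH_of_norm_eq_one (z := X y + y * Complex.I) (by simp; linarith)
      (eisSixDeriv_ne_zero (by simp; linarith)) (by rw [← h, hψ])
    rwa [hval y hy, norm_real, Real.norm_of_nonneg (hφ0 y hy).le] at h1
  have hlarge : ∀ M ≥ 0, ∀ y ≥ M + 100, M < φ y := fun M hM y hy ↦ by
    have hy' : 0.95 ≤ y := by linarith
    have h1 := exists_large_norm_equivariantH (z := X y + y * Complex.I) hM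
      (by simpa using (hX y hy').1.le) (by simpa using (hX y hy').2.1.le) (by simpa using hy)
    rwa [hval y hy', norm_real, Real.norm_of_nonneg (hφ0 y hy').le] at h1
  have hψlow : ψ 0.95 < 1 := by
    by_contra! h
    have h2 := hX 0.95 le_rfl
    refine (equivariantH_im_neg_of_im_le (z := X 0.95 + (0.95 : ℝ) * Complex.I)
      (by simpa using h2.1.le) (by simpa using h2.2.1.le) (by simp; norm_num)
      (by simpa [hψ] using h) (by simp)).ne h2.2.2.1
  have hψhigh : ∀ y ≥ 1, 1 < ψ y := fun y hy ↦ by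
    have h1 := normSq_add_mul_I' (X y) y
    have h2 := (hX y (by linarith)).1
    have h3 : 1 < ‖(X y + y * Complex.I : ℂ)‖ ^ 2 := by rw [h1]; nlinarith
    rw [hψ]
    nlinarith [norm_nonneg (X y + y * Complex.I : ℂ)]
  have hsub : ∀ a ≥ 0.95, ∀ b, Set.Icc a b ⊆ Set.Ici (0.95 : ℝ) := fun a ha b t ht ↦
    le_trans ha ht.1
  obtain ⟨y₁, hy₁, hψ₁⟩ := intermediate_value_Icc (by norm_num) (hψc.mono (hsub 0.95 le_rfl 1))
    (Set.mem_Icc.mpr ⟨hψlow.le, (hψhigh 1 le_rfl).le⟩)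
  have hφ₁ := hone y₁ hy₁.1 hψ₁
  have huniq : ∀ y ≥ 0.95, φ y = 1 → y = y₁ := fun y hy h ↦
    hinj y hy y₁ hy₁.1 (h.trans hφ₁.symm)
  refine ⟨X, y₁, hy₁.1, hX, ⟨by rw [← hψ₁, hψ], by rw [← hφ₁, hφ]⟩, fun y hy hlt ↦ ?_,
    fun y hgt ↦ ?_, fun C hC ↦ ?_⟩
  · by_contra! h
    obtain ⟨t, ht, h1⟩ := intermediate_value_Icc hy (hψc.mono (hsub 0.95 le_rfl y))
      (Set.mem_Icc.mpr ⟨hψlow.le, by rw [hψ]; exact h⟩)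
    have := huniq t ht.1 (hone t ht.1 h1)
    linarith [ht.2]
  · have hy : 0.95 ≤ y := by linarith [hy₁.1]
    constructor
    · by_contra! h
      obtain ⟨t, ht, h1⟩ := intermediate_value_Icc (le_max_left y 1) (hψc.mono (hsub y hy _))
        (Set.mem_Icc.mpr ⟨by rw [hψ]; exact h, (hψhigh _ (le_max_right y 1)).le⟩)
      have h2 := huniq t (hy.trans ht.1) (hone t (hy.trans ht.1) h1)
      linarith [ht.1]
    · by_contra! h
      obtain ⟨t, ht, h1⟩ := intermediate_value_Icc (le_max_left y 101) (hφc.mono (hsub y hy _))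
        (Set.mem_Icc.mpr ⟨by rw [hφ]; exact h, (hlarge 1 zero_le_one _ (by
          linarith [le_max_right y 101])).le⟩)
      have h2 := huniq t (hy.trans ht.1) h1
      linarith [ht.1]
  · have h1 := hlarge C (by linarith) (C + 100) le_rfl
    obtain ⟨t, ht, h2⟩ := intermediate_value_Icc (a := y₁) (b := C + 100) (by linarith [hy₁.2])
      (hφc.mono (hsub y₁ hy₁.1 _)) (Set.mem_Icc.mpr ⟨hφ₁.le.trans hC, h1.le⟩)
    exact ⟨t, ht.1, by rw [← h2, hφ]⟩

/-- On the left half `0 ≤ Re z ≤ 1/2`, `|z| ≥ 1` of the fundamental domain, a real value of `h` is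
at least `1`, with equality exactly on the unit circle. -/
lemma equivariantH_real_of_left {z : ℂ} (h0 : 0 ≤ z.re) (h1 : z.re ≤ 1 / 2) (hz : 0 < z.im)
    (hn : 1 ≤ ‖z‖) (h : (equivariantH z).im = 0) : 0 < z.re ∧ z.re < 1 / 2 ∧ 0.95 ≤ z.im ∧
      1 ≤ (equivariantH z).re ∧ (‖z‖ = 1 ↔ (equivariantH z).re = 1) := by
  have hy : 0.95 ≤ z.im := by
    by_contra! hy
    exact (equivariantH_im_neg_of_im_le h0 h1 hz hn hy.le).ne h
  obtain ⟨X, y₁, hy₁, hX, he, hlow, hhigh, -⟩ := exists_height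
  have h2 := hX z.im hy
  have h3 := h2.2.2.2 z.re h0 h1 (by rwa [Complex.re_add_im])
  have h4 : (X z.im + z.im * Complex.I : ℂ) = z := by rw [← h3, Complex.re_add_im]
  rw [← h3] at h2
  refine ⟨h2.1, h2.2.1, hy, ?_⟩
  rcases lt_trichotomy z.im y₁ with h5 | h5 | h5
  · have := hlow _ hy h5
    rw [h4] at this
    linarith
  · rw [← h5, h4] at he
    simp [he]
  · have := hhigh _ h5
    rw [h4] at this
    exact ⟨this.2.le, iff_of_false this.1.ne' this.2.ne'⟩

lemma exists_equivariantH_eq {C : ℝ} (hC : 1 ≤ C) :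
    ∃ z : ℂ, 0 ≤ z.re ∧ z.re ≤ 1 / 2 ∧ 0 < z.im ∧ 1 ≤ ‖z‖ ∧ equivariantH z = C := by
  obtain ⟨X, y₁, hy₁, hX, he, -, hhigh, hex⟩ := exists_height
  obtain ⟨y, hy, h⟩ := hex C hC
  have h2 := hX y (hy₁.trans hy)
  refine ⟨X y + y * Complex.I, by simpa using h2.1.le, by simpa using h2.2.1.le, by simp; linarith,
    ?_, Complex.ext (by simpa using h) (by simpa using h2.2.2.1)⟩
  rcases hy.eq_or_lt' with rfl | hlt
  · exact he.1.ge
  · exact (hhigh y hlt).1.le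

/-! ### Transport of zeros through the three parts of `F₀` -/

/-- The set `F₀` inside `ℂ`; the condition `|z - 1/2| ≥ 1/2` is written in coordinates. -/
def domF0 : Set ℂ := {z | 0 ≤ z.re ∧ z.re ≤ 1 ∧ 0 < z.im ∧ z.re ≤ z.re ^ 2 + z.im ^ 2}

/-- An open subset of `F₀` (in fact its interior). -/
def domF0Int : Set ℂ := {z | 0 < z.re ∧ z.re < 1 ∧ 0 < z.im ∧ z.re < z.re ^ 2 + z.im ^ 2}

/-- The part `|z| ≥ 1`, `|z - 1| ≥ 1` of `F₀`, a fundamental domain of the full modular group. -/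
def fundDom : Set ℂ := {z | z ∈ domF0 ∧ 1 ≤ z.re ^ 2 + z.im ^ 2 ∧ 1 ≤ (z.re - 1) ^ 2 + z.im ^ 2}

/-- The interior of `fundDom`. -/
def fundDomInt : Set ℂ :=
  {z | z ∈ domF0Int ∧ 1 < z.re ^ 2 + z.im ^ 2 ∧ 1 < (z.re - 1) ^ 2 + z.im ^ 2}

/-- The part of `F₀` which `z ↦ 1/(1 - z)` carries into `fundDom`. -/
def lowerRight : Set ℂ := {z | z ∈ domF0 ∧ (z.re - 1) ^ 2 + z.im ^ 2 < 1 ∧ 1 / 2 ≤ z.re}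

/-- The interior of `lowerRight`. -/
def lowerRightInt : Set ℂ :=
  {z | z ∈ domF0Int ∧ (z.re - 1) ^ 2 + z.im ^ 2 < 1 ∧ 1 / 2 < z.re}

/-- The part of `F₀` which `z ↦ 1 - 1/z` carries into `fundDom`. -/
def lowerLeft : Set ℂ := {z | z ∈ domF0 ∧ z.re ^ 2 + z.im ^ 2 < 1 ∧ z.re ≤ 1 / 2}

/-- The interior of `lowerLeft`. -/
def lowerLeftInt : Set ℂ := {z | z ∈ domF0Int ∧ z.re ^ 2 + z.im ^ 2 < 1 ∧ z.re < 1 / 2}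

lemma mem_domF0_cases {z : ℂ} (hz : z ∈ domF0) : z ∈ fundDom ∨ z ∈ lowerRight ∨ z ∈ lowerLeft := by
  by_cases h1 : 1 ≤ z.re ^ 2 + z.im ^ 2
  · by_cases h2 : 1 ≤ (z.re - 1) ^ 2 + z.im ^ 2
    · exact Or.inl ⟨hz, h1, h2⟩
    · exact Or.inr (Or.inl ⟨hz, not_le.mp h2, by nlinarith⟩)
  · rcases le_total z.re (1 / 2) with h | h
    · exact Or.inr (Or.inr ⟨hz, not_le.mp h1, h⟩)
    · exact Or.inr (Or.inl ⟨hz, by nlinarith, h⟩)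

lemma norm_sq_eq (z : ℂ) : ‖z‖ ^ 2 = z.re ^ 2 + z.im ^ 2 := by
  rw [← normSq_eq_norm_sq, normSq_apply, pow_two, pow_two]

lemma one_le_norm_iff_coord (z : ℂ) : 1 ≤ ‖z‖ ↔ 1 ≤ z.re ^ 2 + z.im ^ 2 := by
  rw [← norm_sq_eq, one_le_sq_iff₀ (norm_nonneg z)]

lemma norm_eq_one_iff_coord (z : ℂ) : ‖z‖ = 1 ↔ z.re ^ 2 + z.im ^ 2 = 1 := by
  rw [← norm_sq_eq, pow_eq_one_iff_of_nonneg (norm_nonneg z) two_ne_zero]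

lemma one_sub_conj_re (z : ℂ) : (1 - (starRingEnd ℂ) z).re = 1 - z.re := by simp

lemma one_sub_conj_im (z : ℂ) : (1 - (starRingEnd ℂ) z).im = z.im := by simp

lemma im_ge_of_mem_fundDom {z : ℂ} (hz : z ∈ fundDom) : 0.866 ≤ z.im := by
  obtain ⟨⟨h1, h2, h3, -⟩, h4, h5⟩ := hz
  rcases le_total z.re (1 / 2) with h | h
  · nlinarith
  · nlinarith

lemma eisSixDeriv_ne_zero_of_mem {z : ℂ} (hz : z ∈ fundDom) : eisSixDeriv z ≠ 0 :=
  eisSixDeriv_ne_zero (im_ge_of_mem_fundDom hz)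

lemma one_sub_conj_mem_fundDom {z : ℂ} (hz : z ∈ fundDom) : 1 - (starRingEnd ℂ) z ∈ fundDom := by
  obtain ⟨⟨h1, h2, h3, h4⟩, h5, h6⟩ := hz
  simp only [fundDom, domF0, Set.mem_ofPred_eq, one_sub_conj_re, one_sub_conj_im]
  refine ⟨⟨?_, ?_, ?_, ?_⟩, ?_, ?_⟩ <;> nlinarith

lemma deriv_equivariantH_one_sub_conj {z : ℂ} (hz : 0 < z.im) (h : eisSixDeriv z ≠ 0) :
    deriv equivariantH (1 - (starRingEnd ℂ) z) = (starRingEnd ℂ) (deriv equivariantH z) := by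
  have e0 : 1 - (starRingEnd ℂ) z = -(starRingEnd ℂ) z + 1 := by ring
  have e1 : eisSixDeriv (1 - (starRingEnd ℂ) z) = (starRingEnd ℂ) (eisSixDeriv z) := by
    rw [e0, eisSixDeriv_add_one, eisSixDeriv_conj]
  have e2 : eisSix (1 - (starRingEnd ℂ) z) = (starRingEnd ℂ) (eisSix z) := by
    rw [e0, eisSix_add_one, eisSix_conj]
  rw [(hasDerivAt_equivariantH hz h).deriv,
    (hasDerivAt_equivariantH (by simpa using hz) (by rw [e1]; simpa using h)).deriv, e1, e2, e0,
    nome_add_one, nome_neg_conj, sigmaSeries_conj]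
  simp [Complex.conj_ofNat]

lemma equivariantH_real_of_left_fundDom {z : ℂ} (hz : z ∈ fundDom) (hl : z.re ≤ 1 / 2)
    (h : (equivariantH z).im = 0) : 0 < z.re ∧ z.re < 1 / 2 ∧ deriv equivariantH z ≠ 0 ∧
      1 ≤ (equivariantH z).re ∧ (z.re ^ 2 + z.im ^ 2 = 1 ↔ (equivariantH z).re = 1) := by
  obtain ⟨⟨h1, h2, h3, h4⟩, h5, h6⟩ := hz
  have h7 := equivariantH_real_of_left h1 hl h3 ((one_le_norm_iff_coord z).mpr h5) h
  refine ⟨h7.1, h7.2.1, fun h8 ↦ ?_, h7.2.2.2.1, ?_⟩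
  · have := equivariantH_deriv_im_neg h7.1 h7.2.1 h7.2.2.1
    rw [h8] at this
    simp at this
  · rw [← norm_eq_one_iff_coord, h7.2.2.2.2]

/-- On the right half of `fundDom` a real value of `h` is at most `0`, by reflection. -/
lemma equivariantH_real_of_right_fundDom {z : ℂ} (hz : z ∈ fundDom) (hl : 1 / 2 ≤ z.re)
    (h : (equivariantH z).im = 0) : 1 / 2 < z.re ∧ z.re < 1 ∧ deriv equivariantH z ≠ 0 ∧
      (equivariantH z).re ≤ 0 ∧ ((z.re - 1) ^ 2 + z.im ^ 2 = 1 ↔ (equivariantH z).re = 0) := by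
  have h1 := equivariantH_real_of_left_fundDom (one_sub_conj_mem_fundDom hz)
    (by rw [one_sub_conj_re]; linarith)
    (by rw [equivariantH_one_sub_conj, one_sub_conj_im, h])
  rw [deriv_equivariantH_one_sub_conj hz.1.2.2.1 (eisSixDeriv_ne_zero_of_mem hz),
    equivariantH_one_sub_conj, one_sub_conj_re, one_sub_conj_im, one_sub_conj_re] at h1
  refine ⟨by linarith, by linarith, by simpa using h1.2.2.1, by linarith, ?_⟩
  rw [show (z.re - 1) ^ 2 = (1 - z.re) ^ 2 by ring, h1.2.2.2.2]
  constructor <;> intro h <;> linarith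

lemma equivariantH_injOn_fundDom {z w : ℂ} (hz : z ∈ fundDom) (hw : w ∈ fundDom)
    (h : (equivariantH z).im = 0) (hzw : equivariantH z = equivariantH w) : z = w := by
  have left : ∀ {z w : ℂ}, z ∈ fundDom → w ∈ fundDom → (equivariantH z).im = 0 →
      equivariantH z = equivariantH w → z.re ≤ 1 / 2 → w.re ≤ 1 / 2 → z = w := by
    intro z w hz hw h hzw hz' hw'
    have h1 := equivariantH_real_of_left hz.1.1 hz' hz.1.2.2.1
      ((one_le_norm_iff_coord z).mpr hz.2.1) h
    have h2 := equivariantH_real_of_left hw.1.1 hw' hw.1.2.2.1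
      ((one_le_norm_iff_coord w).mpr hw.2.1) (hzw ▸ h)
    exact equivariantH_injective h1.1 h1.2.1 h1.2.2.1 h2.1 h2.2.1 h2.2.2.1 hzw
  rcases le_total z.re (1 / 2) with hz' | hz' <;> rcases le_total w.re (1 / 2) with hw' | hw'
  · exact left hz hw h hzw hz' hw'
  · have h1 := (equivariantH_real_of_left_fundDom hz hz' h).2.2.2.1
    have h2 := (equivariantH_real_of_right_fundDom hw hw' (hzw ▸ h)).2.2.2.1
    rw [hzw] at h1
    linarith
  · have h1 := (equivariantH_real_of_right_fundDom hz hz' h).2.2.2.1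
    have h2 := (equivariantH_real_of_left_fundDom hw hw' (hzw ▸ h)).2.2.2.1
    rw [hzw] at h1
    linarith
  · have h1 := left (one_sub_conj_mem_fundDom hz) (one_sub_conj_mem_fundDom hw)
      (by rw [equivariantH_one_sub_conj, one_sub_conj_im, h])
      (by rw [equivariantH_one_sub_conj, equivariantH_one_sub_conj, hzw])
      (by rw [one_sub_conj_re]; linarith) (by rw [one_sub_conj_re]; linarith)
    exact (starRingEnd ℂ).injective (sub_right_injective h1)

lemma exists_mem_fundDom_of_one_le {C : ℝ} (hC : 1 ≤ C) :
    ∃ z ∈ fundDom, z.re ≤ 1 / 2 ∧ equivariantH z = C := by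
  obtain ⟨z, h0, h1, h2, h3, h4⟩ := exists_equivariantH_eq hC
  have h5 := (one_le_norm_iff_coord z).mp h3
  exact ⟨z, ⟨⟨h0, by linarith, h2, by linarith⟩, h5, by nlinarith⟩, h1, h4⟩

lemma exists_mem_fundDom_of_nonpos {C : ℝ} (hC : C ≤ 0) :
    ∃ z ∈ fundDom, 1 / 2 ≤ z.re ∧ equivariantH z = C := by
  obtain ⟨z, h0, h1, h2⟩ := exists_mem_fundDom_of_one_le (C := 1 - C) (by linarith)
  refine ⟨_, one_sub_conj_mem_fundDom h0, by rw [one_sub_conj_re]; linarith, ?_⟩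
  rw [equivariantH_one_sub_conj, h2, conj_ofReal]
  simp

lemma pencil_eq_zero_iff {A B : ℝ} (hB : B ≠ 0) {z : ℂ} (hz : z ∈ fundDom) :
    pencil A B z = 0 ↔ equivariantH z = ((A / B : ℝ) : ℂ) := by
  have h := eisSixDeriv_ne_zero_of_mem hz
  have hB' : (B : ℂ) ≠ 0 := by exact_mod_cast hB
  rw [pencil_eq_mul h, mul_eq_zero, or_iff_right (by simp [h]), sub_eq_zero]
  push_cast
  rw [eq_div_iff hB', mul_comm, eq_comm]

lemma pencil_zero_right_ne_zero {A : ℝ} (hA : A ≠ 0) {z : ℂ} (hz : z ∈ fundDom) :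
    pencil A 0 z ≠ 0 := by
  have h := eisSixDeriv_ne_zero_of_mem hz
  rw [pencil_eq_mul h]
  simp [h, hA]

/-- `f` has a simple zero in `U`, and no other zero in `S`. -/
def HasUniqueSimpleZero (f : ℂ → ℂ) (S U : Set ℂ) : Prop :=
  ∃ z ∈ U, f z = 0 ∧ deriv f z ≠ 0 ∧ ∀ w ∈ S, f w = 0 → w = z

/-- Unique simple zeros are transported by a biholomorphic change of variables `φ` with
`f ∘ φ = u · g`. -/
lemma HasUniqueSimpleZero.transport {f g φ φ' u : ℂ → ℂ} {S U S' U' : Set ℂ}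
    (hg : HasUniqueSimpleZero g S U) (hU : ∀ z ∈ U, φ z ∈ U') (hS : ∀ w ∈ S', φ' w ∈ S)
    (hφ : ∀ w ∈ S', φ (φ' w) = w) (hUim : ∀ z ∈ U, 0 < z.im) (hSim : ∀ z ∈ S, 0 < z.im)
    (he : ∀ z : ℂ, 0 < z.im → f (φ z) = u z * g z) (hu : ∀ z : ℂ, 0 < z.im → u z ≠ 0)
    (hfd : ∀ z ∈ U, DifferentiableAt ℂ f (φ z)) (hφd : ∀ z : ℂ, 0 < z.im → DifferentiableAt ℂ φ z)
    (hud : Differentiable ℂ u) (hgd : ∀ z : ℂ, 0 < z.im → DifferentiableAt ℂ g z) :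
    HasUniqueSimpleZero f S' U' := by
  obtain ⟨z, hz, h0, h1, h2⟩ := hg
  have hz' := hUim z hz
  refine ⟨φ z, hU z hz, by rw [he z hz', h0, mul_zero],
    deriv_ne_zero_of_comp (hfd z hz) (hφd z hz') (hud z) (hgd z hz') ?_ (hu z hz') h0 h1,
    fun w hw hw0 ↦ ?_⟩
  · filter_upwards [isOpen_upperHalfPlaneSet.mem_nhds hz'] with w hw using he w hw
  · have h3 := hSim _ (hS w hw)
    rw [← hφ w hw, he _ h3, mul_eq_zero, or_iff_right (hu _ h3)] at hw0
    rw [← hφ w hw, h2 _ (hS w hw) hw0]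

lemma hasUniqueSimpleZero_fundDom {A B : ℝ} (hB : B ≠ 0) (h : A / B < 0 ∨ 1 < A / B) :
    HasUniqueSimpleZero (pencil A B) fundDom fundDomInt := by
  have key : ∃ z ∈ fundDom, z ∈ fundDomInt ∧ equivariantH z = ((A / B : ℝ) : ℂ) ∧
      deriv equivariantH z ≠ 0 := by
    rcases h with h | h
    · obtain ⟨z, hz, h1, h2⟩ := exists_mem_fundDom_of_nonpos h.le
      obtain ⟨h3, h4, h5, h6, h7⟩ := equivariantH_real_of_right_fundDom hz h1
        (by rw [h2, ofReal_im])
      rw [h2, ofReal_re] at h7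
      have h8 := hz.2.2.lt_of_ne' (fun h9 ↦ h.ne (h7.mp h9))
      exact ⟨z, hz, ⟨⟨by linarith, h4, hz.1.2.2.1, by nlinarith⟩, by nlinarith, h8⟩, h2, h5⟩
    · obtain ⟨z, hz, h1, h2⟩ := exists_mem_fundDom_of_one_le h.le
      obtain ⟨h3, h4, h5, h6, h7⟩ := equivariantH_real_of_left_fundDom hz h1
        (by rw [h2, ofReal_im])
      rw [h2, ofReal_re] at h7
      have h8 := hz.2.1.lt_of_ne' (fun h9 ↦ h.ne' (h7.mp h9))
      exact ⟨z, hz, ⟨⟨h3, by linarith, hz.1.2.2.1, by nlinarith⟩, h8, by nlinarith⟩, h2, h5⟩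
  obtain ⟨z, hz, hzi, h2, h3⟩ := key
  have h0 := (pencil_eq_zero_iff hB hz).mpr h2
  refine ⟨z, hzi, h0, deriv_pencil_ne_zero hB hz.1.2.2.1 (eisSixDeriv_ne_zero_of_mem hz) h0 h3,
    fun w hw hw0 ↦ ?_⟩
  have h4 := (pencil_eq_zero_iff hB hw).mp hw0
  exact equivariantH_injOn_fundDom hw hz (by rw [h4, ofReal_im]) (h4.trans h2.symm)

lemma pencil_ne_zero_of_mem_fundDom {A B : ℝ} (hB : B ≠ 0) (h0 : 0 < A / B) (h1 : A / B < 1)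
    {z : ℂ} (hz : z ∈ fundDom) : pencil A B z ≠ 0 := by
  intro h
  rw [pencil_eq_zero_iff hB hz] at h
  have him : (equivariantH z).im = 0 := by rw [h, ofReal_im]
  rcases le_total z.re (1 / 2) with hl | hl
  · have := (equivariantH_real_of_left_fundDom hz hl him).2.2.2.1
    rw [h, ofReal_re] at this
    linarith
  · have := (equivariantH_real_of_right_fundDom hz hl him).2.2.2.1
    rw [h, ofReal_re] at this
    linarith

/-- Coordinates of the inverse of a point of the upper half-plane. -/
lemma exists_inv_coord {z : ℂ} (hz : 0 < z.im) : ∃ k : ℝ, 0 < k ∧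
    k * (z.re ^ 2 + z.im ^ 2) = 1 ∧ (1 - 1 / z).re = 1 - z.re * k ∧ (1 - 1 / z).im = z.im * k := by
  have hn : 0 < z.re ^ 2 + z.im ^ 2 := by positivity
  refine ⟨(z.re ^ 2 + z.im ^ 2)⁻¹, by positivity, inv_mul_cancel₀ hn.ne', ?_, ?_⟩
  · rw [one_div, sub_re, inv_re, normSq_apply, ← pow_two, ← pow_two, div_eq_mul_inv, one_re]
  · rw [one_div, sub_im, inv_im, normSq_apply, ← pow_two, ← pow_two, div_eq_mul_inv, one_im]
    ring

lemma exists_inv_one_sub_coord {z : ℂ} (hz : 0 < z.im) : ∃ k : ℝ, 0 < k ∧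
    k * ((z.re - 1) ^ 2 + z.im ^ 2) = 1 ∧ (1 / (1 - z)).re = (1 - z.re) * k ∧
    (1 / (1 - z)).im = z.im * k := by
  have hn : 0 < (z.re - 1) ^ 2 + z.im ^ 2 := by positivity
  have e : normSq (1 - z) = (z.re - 1) ^ 2 + z.im ^ 2 := by
    rw [normSq_apply, sub_re, sub_im, one_re, one_im]
    ring
  refine ⟨((z.re - 1) ^ 2 + z.im ^ 2)⁻¹, by positivity, inv_mul_cancel₀ hn.ne', ?_, ?_⟩
  · rw [one_div, inv_re, e, div_eq_mul_inv, sub_re, one_re]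
  · rw [one_div, inv_im, e, div_eq_mul_inv, sub_im, one_im]
    ring

lemma rotate_mem_fundDom {z : ℂ} (hz : z ∈ lowerRight) :
    1 / (1 - z) ∈ fundDom ∧ 1 < (1 / (1 - z)).re ^ 2 + (1 / (1 - z)).im ^ 2 := by
  obtain ⟨⟨h1, h2, h3, h4⟩, h5, h6⟩ := hz
  obtain ⟨k, hk, hn, hre, him⟩ := exists_inv_one_sub_coord h3
  have e : ((1 - z.re) * k) ^ 2 + (z.im * k) ^ 2 = k := by linear_combination k * hn
  have hk1 : 1 < k := by nlinarith
  have hp : (1 - z.re) * k ≤ 1 := by nlinarith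
  simp only [fundDom, domF0, Set.mem_ofPred_eq, hre, him]
  refine ⟨⟨⟨mul_nonneg (by linarith) hk.le, hp, by positivity, by linarith⟩, by linarith, ?_⟩,
    by linarith⟩
  nlinarith

lemma rotate_symm_mem_fundDom {z : ℂ} (hz : z ∈ lowerLeft) :
    1 - 1 / z ∈ fundDom ∧ 1 < ((1 - 1 / z).re - 1) ^ 2 + (1 - 1 / z).im ^ 2 := by
  obtain ⟨⟨h1, h2, h3, h4⟩, h5, h6⟩ := hz
  obtain ⟨k, hk, hn, hre, him⟩ := exists_inv_coord h3
  have e : (z.re * k) ^ 2 + (z.im * k) ^ 2 = k := by linear_combination k * hn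
  have hk1 : 1 < k := by nlinarith
  have hp : z.re * k ≤ 1 := by nlinarith
  have hp0 : 0 ≤ z.re * k := by positivity
  simp only [fundDom, domF0, Set.mem_ofPred_eq, hre, him]
  refine ⟨⟨⟨by linarith, by linarith, by positivity, by nlinarith⟩, by nlinarith, by nlinarith⟩,
    by nlinarith⟩

lemma rotate_symm_mem_lowerRightInt {z : ℂ} (hz : z ∈ fundDomInt) :
    1 - 1 / z ∈ lowerRightInt := by
  obtain ⟨⟨h1, h2, h3, h4⟩, h5, h6⟩ := hz
  obtain ⟨k, hk, hn, hre, him⟩ := exists_inv_coord h3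
  have e : (z.re * k) ^ 2 + (z.im * k) ^ 2 = k := by linear_combination k * hn
  have hp0 : 0 < z.re * k := by positivity
  have hp1 : z.re * k < 1 / 2 := by nlinarith
  have hk1 : k < 1 := by nlinarith
  simp only [lowerRightInt, domF0Int, Set.mem_ofPred_eq, hre, him]
  refine ⟨⟨by linarith, by linarith, by positivity, by nlinarith⟩, by nlinarith, by linarith⟩

lemma rotate_mem_lowerLeftInt {z : ℂ} (hz : z ∈ fundDomInt) :
    1 / (1 - z) ∈ lowerLeftInt := by
  obtain ⟨⟨h1, h2, h3, h4⟩, h5, h6⟩ := hz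
  obtain ⟨k, hk, hn, hre, him⟩ := exists_inv_one_sub_coord h3
  have e : ((1 - z.re) * k) ^ 2 + (z.im * k) ^ 2 = k := by linear_combination k * hn
  have hp0 : 0 < (1 - z.re) * k := mul_pos (by linarith) hk
  have hp1 : (1 - z.re) * k < 1 / 2 := by nlinarith
  have hk1 : k < 1 := by nlinarith
  simp only [lowerLeftInt, domF0Int, Set.mem_ofPred_eq, hre, him]
  refine ⟨⟨hp0, by linarith, by positivity, by nlinarith⟩, by linarith, hp1⟩

lemma rotate_symm_rotate (z : ℂ) : 1 - 1 / (1 / (1 - z)) = z := by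
  rw [one_div_one_div]
  ring

lemma rotate_rotate_symm (z : ℂ) : 1 / (1 - (1 - 1 / z)) = z := by
  rw [sub_sub_cancel, one_div_one_div]

lemma differentiableAt_pencil (A B : ℝ) {z : ℂ} (hz : 0 < z.im) :
    DifferentiableAt ℂ (pencil A B) z :=
  (differentiableOn_pencil A B).differentiableAt (isOpen_upperHalfPlaneSet.mem_nhds hz)

lemma ne_zero_of_im_pos {z : ℂ} (hz : 0 < z.im) : z ≠ 0 := by
  rintro rfl
  simp at hz

lemma sub_one_ne_zero_of_im_pos {z : ℂ} (hz : 0 < z.im) : z - 1 ≠ 0 :=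
  ne_zero_of_im_pos (by simpa using hz)

lemma hasUniqueSimpleZero_lowerRight {C : ℝ} (hC : 1 - C ≠ 0)
    (h : 1 / (1 - C) < 0 ∨ 1 < 1 / (1 - C)) :
    HasUniqueSimpleZero (pencil C 1) lowerRight lowerRightInt :=
  (hasUniqueSimpleZero_fundDom hC h).transport (φ := fun z ↦ 1 - 1 / z) (φ' := fun z ↦ 1 / (1 - z))
    (u := fun z ↦ z ^ 7) (fun _ ↦ rotate_symm_mem_lowerRightInt)
    (fun _ hw ↦ (rotate_mem_fundDom hw).1) (fun _ _ ↦ rotate_symm_rotate _)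
    (fun _ hz ↦ hz.1.2.2.1) (fun _ hz ↦ hz.1.2.2.1) (fun _ hz ↦ pencil_rotate_symm C 1 hz)
    (fun _ hz ↦ pow_ne_zero 7 (ne_zero_of_im_pos hz))
    (fun _ hz ↦ differentiableAt_pencil _ _ (rotate_symm_mem_lowerRightInt hz).1.2.2.1)
    (fun z hz ↦ by
      have := ne_zero_of_im_pos hz
      fun_prop (disch := assumption))
    (by fun_prop) (fun _ hz ↦ differentiableAt_pencil _ _ hz)

lemma hasUniqueSimpleZero_lowerLeft {C : ℝ} (hC : -C ≠ 0)
    (h : (1 - C) / (-C) < 0 ∨ 1 < (1 - C) / (-C)) :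
    HasUniqueSimpleZero (pencil C 1) lowerLeft lowerLeftInt :=
  (hasUniqueSimpleZero_fundDom hC h).transport (φ := fun z ↦ 1 / (1 - z)) (φ' := fun z ↦ 1 - 1 / z)
    (u := fun z ↦ (z - 1) ^ 7) (fun _ ↦ rotate_mem_lowerLeftInt)
    (fun _ hw ↦ (rotate_symm_mem_fundDom hw).1) (fun _ _ ↦ rotate_rotate_symm _)
    (fun _ hz ↦ hz.1.2.2.1) (fun _ hz ↦ hz.1.2.2.1) (fun _ hz ↦ pencil_rotate C 1 hz)
    (fun _ hz ↦ pow_ne_zero 7 (sub_one_ne_zero_of_im_pos hz))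
    (fun _ hz ↦ differentiableAt_pencil _ _ (rotate_mem_lowerLeftInt hz).1.2.2.1)
    (fun z hz ↦ by
      have : 1 - z ≠ 0 := by
        rw [← neg_sub]
        exact neg_ne_zero.mpr (sub_one_ne_zero_of_im_pos hz)
      fun_prop (disch := assumption))
    (by fun_prop) (fun _ hz ↦ differentiableAt_pencil _ _ hz)

lemma pencil_ne_zero_of_mem_lowerRight {C : ℝ} {z : ℂ} (hz : z ∈ lowerRight)
    (h : pencil 1 (1 - C) (1 / (1 - z)) ≠ 0) : pencil C 1 z ≠ 0 := by
  have h3 := (rotate_mem_fundDom hz).1.1.2.2.1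
  rw [← rotate_symm_rotate z, pencil_rotate_symm C 1 h3]
  exact mul_ne_zero (pow_ne_zero 7 (ne_zero_of_im_pos h3)) h

lemma pencil_ne_zero_of_mem_lowerLeft {C : ℝ} {z : ℂ} (hz : z ∈ lowerLeft)
    (h : pencil (1 - C) (-C) (1 - 1 / z) ≠ 0) : pencil C 1 z ≠ 0 := by
  have h3 := (rotate_symm_mem_fundDom hz).1.1.2.2.1
  rw [← rotate_rotate_symm z, pencil_rotate C 1 h3]
  exact mul_ne_zero (pow_ne_zero 7 (sub_one_ne_zero_of_im_pos h3)) h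

/-- Two unique zeros in disjoint regions, and none in the third one. -/
lemma exists_pair_of_regions {f : ℂ → ℂ} {S T V U₁ U₂ : Set ℂ}
    (hc : ∀ z ∈ domF0, z ∈ S ∨ z ∈ T ∨ z ∈ V) (h1 : HasUniqueSimpleZero f S U₁)
    (h2 : HasUniqueSimpleZero f T U₂) (h3 : ∀ z ∈ V, f z ≠ 0) (hd : ∀ z ∈ U₁, z ∉ U₂)
    (hU₁ : U₁ ⊆ domF0Int) (hU₂ : U₂ ⊆ domF0Int) :
    ∃ a ∈ domF0Int, ∃ b ∈ domF0Int, a ≠ b ∧ f a = 0 ∧ f b = 0 ∧ deriv f a ≠ 0 ∧ deriv f b ≠ 0 ∧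
      ∀ z ∈ domF0, f z = 0 → z = a ∨ z = b := by
  obtain ⟨a, ha, ha0, ha1, ha2⟩ := h1
  obtain ⟨b, hb, hb0, hb1, hb2⟩ := h2
  refine ⟨a, hU₁ ha, b, hU₂ hb, ?_, ha0, hb0, ha1, hb1, fun z hz hz0 ↦ ?_⟩
  · rintro rfl
    exact hd a ha hb
  · rcases hc z hz with h | h | h
    · exact Or.inl (ha2 z h hz0)
    · exact Or.inr (hb2 z h hz0)
    · exact absurd hz0 (h3 z h)

/-- Of the three values `C`, `1/(1 - C)`, `(C - 1)/C` exactly one lies in `(0, 1)`, and the other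
two lie outside `[0, 1]`; each of these gives one zero, in its own part of `F₀`. -/
lemma exists_pair_of_zeros {C : ℝ} (h0 : C ≠ 0) (h1 : C ≠ 1) :
    ∃ a ∈ domF0Int, ∃ b ∈ domF0Int, a ≠ b ∧ pencil C 1 a = 0 ∧ pencil C 1 b = 0 ∧
      deriv (pencil C 1) a ≠ 0 ∧ deriv (pencil C 1) b ≠ 0 ∧
      ∀ z ∈ domF0, pencil C 1 z = 0 → z = a ∨ z = b := by
  have h1' : 1 - C ≠ 0 := sub_ne_zero.mpr h1.symm
  have h0' : -C ≠ 0 := neg_ne_zero.mpr h0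
  rcases lt_or_gt_of_ne h0 with hC | hC
  · refine exists_pair_of_regions (S := fundDom) (T := lowerLeft) (V := lowerRight)
      (fun z hz ↦ (mem_domF0_cases hz).imp_right Or.symm)
      (hasUniqueSimpleZero_fundDom one_ne_zero (Or.inl (by simpa using hC)))
      (hasUniqueSimpleZero_lowerLeft h0' (Or.inr ?_))
      (fun z hz ↦ pencil_ne_zero_of_mem_lowerRight hz (pencil_ne_zero_of_mem_fundDom h1' ?_ ?_
        (rotate_mem_fundDom hz).1)) (fun z hz hz' ↦ by linarith [hz.2.1, hz'.2.1])
      (fun z hz ↦ hz.1) (fun z hz ↦ hz.1)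
    · rw [lt_div_iff₀ (by linarith)]
      linarith
    · exact div_pos one_pos (by linarith)
    · rw [div_lt_one (by linarith)]
      linarith
  rcases lt_or_gt_of_ne h1 with hC1 | hC1
  · refine exists_pair_of_regions (S := lowerRight) (T := lowerLeft) (V := fundDom)
      (fun z hz ↦ (mem_domF0_cases hz).elim (fun h ↦ Or.inr (Or.inr h))
        (fun h ↦ h.imp_right Or.inl))
      (hasUniqueSimpleZero_lowerRight h1' (Or.inr ?_))
      (hasUniqueSimpleZero_lowerLeft h0' (Or.inl ?_))
      (fun z hz ↦ pencil_ne_zero_of_mem_fundDom one_ne_zero (by simpa using hC)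
        (by simpa using hC1) hz) (fun z hz hz' ↦ by linarith [hz.2.2, hz'.2.2])
      (fun z hz ↦ hz.1) (fun z hz ↦ hz.1)
    · rw [lt_div_iff₀ (by linarith)]
      linarith
    · exact div_neg_of_pos_of_neg (by linarith) (by linarith)
  · refine exists_pair_of_regions (S := fundDom) (T := lowerRight) (V := lowerLeft)
      (fun z hz ↦ mem_domF0_cases hz)
      (hasUniqueSimpleZero_fundDom one_ne_zero (Or.inr (by simpa using hC1)))
      (hasUniqueSimpleZero_lowerRight h1' (Or.inl ?_))
      (fun z hz ↦ pencil_ne_zero_of_mem_lowerLeft hz (pencil_ne_zero_of_mem_fundDom h0' ?_ ?_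
        (rotate_symm_mem_fundDom hz).1)) (fun z hz hz' ↦ by linarith [hz.2.2, hz'.2.1])
      (fun z hz ↦ hz.1) (fun z hz ↦ hz.1)
    · exact div_neg_of_pos_of_neg one_pos (by linarith)
    · exact div_pos_of_neg_of_neg (by linarith) (by linarith)
    · rw [div_lt_one_of_neg (by linarith)]
      linarith

/-! ### The exceptional parameters `0`, `1`, `∞` -/

/-- The exceptional point on the unit circle where `h = 1`. -/
lemma exists_tauOne : ∃ z ∈ fundDom, 0 < z.re ∧ z.re < 1 / 2 ∧ z.re ^ 2 + z.im ^ 2 = 1 ∧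
    equivariantH z = 1 ∧ ∀ w ∈ fundDom, equivariantH w = 1 → w = z := by
  obtain ⟨z, hz, h1, h2⟩ := exists_mem_fundDom_of_one_le le_rfl
  rw [ofReal_one] at h2
  have h3 := equivariantH_real_of_left_fundDom hz h1 (by rw [h2, one_im])
  exact ⟨z, hz, h3.1, h3.2.1, h3.2.2.2.2.mpr (by rw [h2, one_re]), h2, fun w hw hw1 ↦
    equivariantH_injOn_fundDom hw hz (by rw [hw1, one_im]) (hw1.trans h2.symm)⟩

lemma normSq_eq_one_of_equivariantH_eq_one {z : ℂ} (hz : z ∈ fundDom) (h : equivariantH z = 1) :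
    z.re ^ 2 + z.im ^ 2 = 1 := by
  obtain ⟨w, hw, -, -, h1, -, h2⟩ := exists_tauOne
  rwa [h2 z hz h]

lemma equivariantH_eq_zero_iff {z : ℂ} :
    equivariantH z = 0 ↔ equivariantH (1 - (starRingEnd ℂ) z) = 1 := by
  rw [equivariantH_one_sub_conj, sub_eq_self, map_eq_zero]

lemma normSq_sub_one_eq_one_of_equivariantH_eq_zero {z : ℂ} (hz : z ∈ fundDom)
    (h : equivariantH z = 0) : (z.re - 1) ^ 2 + z.im ^ 2 = 1 := by
  have := normSq_eq_one_of_equivariantH_eq_one (one_sub_conj_mem_fundDom hz)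
    (equivariantH_eq_zero_iff.mp h)
  rw [one_sub_conj_re, one_sub_conj_im] at this
  linarith [this]

/-- In `F₀` the function `pencil 1 1` vanishes only in `fundDom`, where `h = 1`. -/
lemma pencil_one_one_eq_zero_iff {z : ℂ} (hz : z ∈ domF0) :
    pencil 1 1 z = 0 ↔ z ∈ fundDom ∧ equivariantH z = 1 := by
  constructor
  · intro h
    rcases mem_domF0_cases hz with h1 | h1 | h1
    · exact ⟨h1, by simpa using (pencil_eq_zero_iff one_ne_zero h1).mp h⟩
    · refine absurd h (pencil_ne_zero_of_mem_lowerRight h1 ?_)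
      rw [sub_self]
      exact pencil_zero_right_ne_zero one_ne_zero (rotate_mem_fundDom h1).1
    · refine absurd h (pencil_ne_zero_of_mem_lowerLeft h1 fun h2 ↦ ?_)
      obtain ⟨h3, h4⟩ := rotate_symm_mem_fundDom h1
      rw [pencil_eq_zero_iff (by norm_num) h3, sub_self, zero_div, ofReal_zero] at h2
      exact h4.ne' (normSq_sub_one_eq_one_of_equivariantH_eq_zero h3 h2)
  · rintro ⟨h1, h2⟩
    rw [pencil_eq_zero_iff one_ne_zero h1, h2]
    simp

/-- In `F₀` the function `pencil 0 1` vanishes only in `fundDom`, where `h = 0`. -/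
lemma pencil_zero_one_eq_zero_iff {z : ℂ} (hz : z ∈ domF0) :
    pencil 0 1 z = 0 ↔ z ∈ fundDom ∧ equivariantH z = 0 := by
  constructor
  · intro h
    rcases mem_domF0_cases hz with h1 | h1 | h1
    · exact ⟨h1, by simpa using (pencil_eq_zero_iff one_ne_zero h1).mp h⟩
    · refine absurd h (pencil_ne_zero_of_mem_lowerRight h1 fun h2 ↦ ?_)
      obtain ⟨h3, h4⟩ := rotate_mem_fundDom h1
      rw [sub_zero, pencil_eq_zero_iff one_ne_zero h3, div_one, ofReal_one] at h2
      exact h4.ne' (normSq_eq_one_of_equivariantH_eq_one h3 h2)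
    · refine absurd h (pencil_ne_zero_of_mem_lowerLeft h1 ?_)
      rw [sub_zero, neg_zero]
      exact pencil_zero_right_ne_zero one_ne_zero (rotate_symm_mem_fundDom h1).1
  · rintro ⟨h1, h2⟩
    rw [pencil_eq_zero_iff one_ne_zero h1, h2]
    simp

/-- `E₆'` has no zero in `fundDom`; its zeros in the rest of `F₀` are rotated onto the points
where `h = 0` or `h = 1`. -/
lemma pencil_one_zero_eq_zero {z : ℂ} (hz : z ∈ domF0) (h : pencil 1 0 z = 0) :
    (1 / (1 - z) ∈ fundDom ∧ equivariantH (1 / (1 - z)) = 0) ∨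
      (1 - 1 / z ∈ fundDom ∧ equivariantH (1 - 1 / z) = 1) := by
  rcases mem_domF0_cases hz with h1 | h1 | h1
  · exact absurd h (pencil_zero_right_ne_zero one_ne_zero h1)
  · have h2 := (rotate_mem_fundDom h1).1
    have h3 := h2.1.2.2.1
    rw [← rotate_symm_rotate z, pencil_rotate_symm 1 0 h3, mul_eq_zero,
      or_iff_right (pow_ne_zero 7 (ne_zero_of_im_pos h3)),
      pencil_eq_zero_iff (by norm_num) h2, zero_div, ofReal_zero] at h
    exact Or.inl ⟨h2, h⟩
  · have h2 := (rotate_symm_mem_fundDom h1).1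
    have h3 := h2.1.2.2.1
    rw [← rotate_rotate_symm z, pencil_rotate 1 0 h3, mul_eq_zero,
      or_iff_right (pow_ne_zero 7 (sub_one_ne_zero_of_im_pos h3)),
      pencil_eq_zero_iff (by norm_num) h2] at h
    exact Or.inr ⟨h2, by simpa using h⟩

lemma mem_F0_iff (τ : ℍ) : τ ∈ F0 ↔ (τ : ℂ) ∈ domF0 := by
  have h : ‖(τ : ℂ) - 1 / 2‖ ^ 2 = (τ.re - 1 / 2) ^ 2 + τ.im ^ 2 := by
    rw [norm_sq_eq]
    simp
  have h2 : 1 / 2 ≤ ‖(τ : ℂ) - 1 / 2‖ ↔ τ.re ≤ τ.re ^ 2 + τ.im ^ 2 := by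
    rw [← sq_le_sq₀ (by norm_num) (norm_nonneg _), h]
    constructor <;> intro h <;> nlinarith
  simp only [F0, domF0, Set.mem_ofPred_eq, h2, coe_re, coe_im, τ.im_pos, true_and]

lemma mem_interior_F0 {τ : ℍ} (h : (τ : ℂ) ∈ domF0Int) : τ ∈ interior F0 := by
  refine interior_maximal (s := F0) (t := {σ : ℍ | (σ : ℂ) ∈ domF0Int}) (fun σ hσ ↦ ?_) ?_ h
  · exact (mem_F0_iff σ).mpr ⟨hσ.1.le, hσ.2.1.le, hσ.2.2.1, hσ.2.2.2.le⟩
  · have h1 := UpperHalfPlane.continuous_re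
    have h2 := UpperHalfPlane.continuous_im
    exact ((isOpen_lt continuous_const h1).inter ((isOpen_lt h1 continuous_const).inter
      ((isOpen_lt continuous_const h2).inter (isOpen_lt h1 (by fun_prop)))))

lemma fC_eq_zero_iff (C : ℝ) (τ : ℍ) : fC C τ = 0 ↔ pencil C 1 τ = 0 := by
  rw [fC_eq_pencil, mul_eq_zero, or_iff_right (by simp)]

lemma derivH_g3_eq_zero_iff_pencil (τ : ℍ) : derivH g3 τ = 0 ↔ pencil 1 0 τ = 0 := by
  rw [derivH_g3_eq_zero_iff, pencil, eisSixDeriv]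
  simp

end

theorem theorem3p1 :
    (∀ C : ℝ, C ≠ 0 → C ≠ 1 →
      {τ : ℍ | τ ∈ F0 ∧ fC C τ = 0}.encard = 2 ∧
      ∀ τ ∈ F0, fC C τ = 0 → τ ∈ interior F0 ∧ IsSimpleZero (fC C) τ) ∧
    ∃ τinf τ₀ τ₁ : ℍ,
      (∀ τ ∈ F0, derivH g3 τ = 0 ↔ τ = τinf) ∧
      τinf ∈ F0 ∧ τinf.re = 1 / 2 ∧ 1 / 2 < τinf.im ∧ τinf.im < √3 / 2 ∧
      ((τ₀ : ℂ) = 1 / (1 - (τinf : ℂ)) ∧ τ₀ ∈ interior F0 ∧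
        (∀ τ ∈ F0, fC 0 τ = 0 ↔ τ = τ₀) ∧
        1 / 2 < τ₀.re ∧ ‖(τ₀ : ℂ) - 1‖ = 1) ∧
      ((τ₁ : ℂ) = ((τinf : ℂ) - 1) / (τinf : ℂ) ∧ τ₁ ∈ interior F0 ∧
        (∀ τ ∈ F0, fC 1 τ = 0 ↔ τ = τ₁) ∧
        (τ₁ : ℂ) = 1 - (starRingEnd ℂ) (τ₀ : ℂ) ∧
        τ₁.re < 1 / 2 ∧ ‖(τ₁ : ℂ)‖ = 1) := by
  refine ⟨fun C h0 h1 ↦ ?_, ?_⟩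
  · obtain ⟨a, ha, b, hb, hab, ha0, hb0, ha1, hb1, huniq⟩ := exists_pair_of_zeros h0 h1
    have hsub : ∀ z ∈ domF0Int, z ∈ domF0 := fun z hz ↦
      ⟨hz.1.le, hz.2.1.le, hz.2.2.1, hz.2.2.2.le⟩
    lift a to ℍ using ha.2.2.1
    lift b to ℍ using hb.2.2.1
    have hset : {τ : ℍ | τ ∈ F0 ∧ fC C τ = 0} = {a, b} := by
      ext τ
      simp only [Set.mem_ofPred_eq, Set.mem_insert_iff, Set.mem_singleton_iff, mem_F0_iff,
        fC_eq_zero_iff]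
      constructor
      · rintro ⟨h, h2⟩
        exact (huniq τ h h2).imp (fun h ↦ UpperHalfPlane.ext h) (fun h ↦ UpperHalfPlane.ext h)
      · rintro (rfl | rfl)
        · exact ⟨hsub _ ha, ha0⟩
        · exact ⟨hsub _ hb, hb0⟩
    refine ⟨?_, fun τ hτ hτ0 ↦ ?_⟩
    · rw [hset]
      exact Set.encard_pair fun h ↦ hab (congrArg _ h)
    · have : τ ∈ ({a, b} : Set ℍ) := hset ▸ ⟨hτ, hτ0⟩
      rcases this with rfl | rfl
      · exact ⟨mem_interior_F0 ha, isSimpleZero_fC ha0 ha1⟩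
      · exact ⟨mem_interior_F0 hb, isSimpleZero_fC hb0 hb1⟩
  · obtain ⟨t, ht, hre0, hre1, hn, hH, huniq⟩ := exists_tauOne
    have htim := ht.1.2.2.1
    have hs := one_sub_conj_mem_fundDom ht
    have huniq0 : ∀ w ∈ fundDom, equivariantH w = 0 → w = 1 - (starRingEnd ℂ) t := by
      intro w hw hw0
      have h1 := huniq _ (one_sub_conj_mem_fundDom hw) (equivariantH_eq_zero_iff.mp hw0)
      rw [← h1]
      simp
    have hH0 : equivariantH (1 - (starRingEnd ℂ) t) = 0 := by
      rw [equivariantH_one_sub_conj, hH]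
      simp
    obtain ⟨k, hk, hkn, hkre, hkim⟩ := exists_inv_one_sub_coord htim
    -- On the unit circle `|1 - t|² = 2 (1 - Re t)`, so `1/(1 - t)` has real part `1/2`.
    have hk2 : k * (2 * (1 - t.re)) = 1 := by
      linear_combination hkn - k * hn
    have hτre : (1 / (1 - t)).re = 1 / 2 := by
      rw [hkre]
      linarith
    have hτim : 0 < (1 / (1 - t)).im := by
      rw [hkim]
      positivity
    have hτsq : (1 / (1 - t)).im ^ 2 = k - 1 / 4 := by
      have : (1 / (1 - t)).re ^ 2 + (1 / (1 - t)).im ^ 2 = k := by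
        rw [hkre, hkim]
        linear_combination k * hkn
      rw [hτre] at this
      linarith
    have hk_lt : 1 / 2 < k := by nlinarith
    have hk_gt : k < 1 := by nlinarith
    have ht1 : 1 - t ≠ 0 := by
      rw [← neg_sub]
      exact neg_ne_zero.mpr (sub_one_ne_zero_of_im_pos htim)
    have hτ0 := ne_zero_of_im_pos hτim
    -- The third point of the orbit of `t`, written through the reflection of `t`.
    have hconj : 1 / (1 - 1 / (1 - t)) = 1 - (starRingEnd ℂ) t := by
      have h2 : t * (starRingEnd ℂ) t = 1 := by
        rw [Complex.mul_conj, Complex.normSq_apply, ← pow_two, ← pow_two, hn, Complex.ofReal_one]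
      have h3 : 1 - 1 / (1 - t) = -t / (1 - t) := by
        field_simp
        ring
      rw [h3, one_div_div, div_eq_iff (neg_ne_zero.mpr (ne_zero_of_im_pos htim))]
      linear_combination -h2
    have hτdom : 1 / (1 - t) ∈ domF0 := by
      refine ⟨by rw [hτre]; norm_num, by rw [hτre]; norm_num, hτim, ?_⟩
      rw [hτsq, hτre]
      linarith
    have hτzero : pencil 1 0 (1 / (1 - t)) = 0 := by
      rw [pencil_rotate 1 0 htim, (pencil_eq_zero_iff (by norm_num) ht).mpr (by rw [hH]; simp),
        mul_zero]
    have hint1 : t ∈ domF0Int := ⟨hre0, by linarith, htim, by linarith⟩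
    have hint0 : 1 - (starRingEnd ℂ) t ∈ domF0Int := by
      rw [domF0Int, Set.mem_ofPred_eq, one_sub_conj_re, one_sub_conj_im]
      exact ⟨by linarith, by linarith, htim, by nlinarith⟩
    refine ⟨⟨1 / (1 - t), hτim⟩, ⟨1 - (starRingEnd ℂ) t, hint0.2.2.1⟩, ⟨t, htim⟩,
      fun τ hτ ↦ ?_, (mem_F0_iff _).mpr hτdom, hτre, ?_, ?_,
      ⟨hconj.symm, mem_interior_F0 hint0, fun τ hτ ↦ ?_, ?_, ?_⟩,
      ⟨?_, mem_interior_F0 hint1, fun τ hτ ↦ ?_, ?_, hre1, (norm_eq_one_iff_coord t).mpr hn⟩⟩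
    · rw [mem_F0_iff] at hτ
      rw [derivH_g3_eq_zero_iff_pencil, UpperHalfPlane.ext_iff]
      constructor
      · intro h
        rcases pencil_one_zero_eq_zero hτ h with ⟨h1, h2⟩ | ⟨h1, h2⟩
        · have h3 := huniq0 _ h1 h2
          rw [← hconj] at h3
          have h4 := congrArg (fun z : ℂ ↦ 1 - 1 / z) h3
          simpa only [rotate_symm_rotate] using h4
        · have h3 := huniq _ h1 h2
          change (τ : ℂ) = 1 / (1 - t)
          rw [← h3, rotate_rotate_symm]
      · intro h
        rw [h]
        exact hτzero
    · change 1 / 2 < (1 / (1 - t)).im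
      nlinarith
    · change (1 / (1 - t)).im < √3 / 2
      rw [lt_div_iff₀ two_pos]
      refine Real.lt_sqrt_of_sq_lt ?_
      nlinarith
    · rw [mem_F0_iff] at hτ
      rw [fC_eq_zero_iff, pencil_zero_one_eq_zero_iff hτ, UpperHalfPlane.ext_iff]
      exact ⟨fun h ↦ huniq0 _ h.1 h.2, fun h ↦ by rw [h]; exact ⟨hs, hH0⟩⟩
    · change 1 / 2 < (1 - (starRingEnd ℂ) t).re
      rw [one_sub_conj_re]
      linarith
    · change ‖1 - (starRingEnd ℂ) t - 1‖ = 1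
      rw [sub_sub_cancel_left, norm_neg, RCLike.norm_conj]
      exact (norm_eq_one_iff_coord t).mpr hn
    · change t = (1 / (1 - t) - 1) / (1 / (1 - t))
      rw [sub_div, div_self hτ0, rotate_symm_rotate]
    · rw [mem_F0_iff] at hτ
      rw [fC_eq_zero_iff, pencil_one_one_eq_zero_iff hτ, UpperHalfPlane.ext_iff]
      exact ⟨fun h ↦ huniq _ h.1 h.2, fun h ↦ by rw [h]; exact ⟨ht, hH⟩⟩
    · change t = 1 - (starRingEnd ℂ) (1 - (starRingEnd ℂ) t)
      simp
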